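/- There is a universal constant $C>0$ with the following property. Let $\mathbb T=\mathbb R/\mathbb Z$ carry its quotient distance $|\cdot|$ and normalized Lebesgue measure (used for all $L^p$ norms below). For a complex Borel measure $\mu$ on $\mathbb T$ let $\|\mu\|=|\mu|(\mathbb T)$ be its total variation norm, let $\hat\mu(m)=\int_{\mathbb T}e^{-2\pi i m x}\,d\mu(x)$ for $m\in\mathbb Z$, and for an integer $M>0$ let $P_M\mu(x)=\sum_{m=-M}^{M}\hat\mu(m)e^{2\pi i m x}$. Let $M\ge 128$ be an integer and $\epsilon\ge 0$. Let $\mu_0=\sum_{j=1}^{J}a_j\delta_{s_j}$ be a discrete complex measure ($J\ge 0$, $a_j\in\mathbb C\setminus\{0\}$, $s_j\in\mathbb T$ distinct) whose support satisfies $|s_j-s_k|\ge 2/M$ for all $j\ne k$, and let $\mu$ be a complex Borel measure on $\mathbb T$ such that \[ \|\mu\|\le\|\mu_0\|+2\epsilon\qquad\text{and}\qquad \|P_M(\mu-\mu_0)\|_{L^2(\mathbb T)}\le 2\epsilon . \] Then for every twice differentiable function $K:\mathbb T\to\mathbb C$ with $K''\in L^\infty(\mathbb T)$, the convolution $K*(\mu-\mu_0)(x)=\int_{\mathbb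 T}K(x-y)\,d(\mu-\mu_0)(y)$ satisfies \[ \|K*(\mu-\mu_0)\|_{L^\infty}\le C\,\epsilon\,\bigl(\|K\|_{L^\infty}+M^{-1}\|K'\|_{L^\infty}+M^{-2}\|K''\|_{L^\infty}\bigr). \] -/

import Mathlib

open MeasureTheory
open scoped ENNReal NNReal

noncomputable section

namespace SuperResolution

/-- The torus `𝕋 = ℝ / ℤ`, with its quotient distance and its Haar (= Lebesgue) probability
measure `volume`. -/
abbrev Torus : Type := AddCircle (1 : ℝ)

/-- The integral `∫ f dμ` of a complex function against a complex Borel measure on the torus. -/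
def cintegral (μ : ComplexMeasure Torus) (f : Torus → ℂ) : ℂ :=
  VectorMeasure.integral μ f (ContinuousLinearMap.mul ℝ ℂ)

/-- The total variation norm `‖μ‖ = |μ|(𝕋)`. -/
def tvNorm (μ : ComplexMeasure Torus) : ℝ≥0∞ :=
  VectorMeasure.variation μ Set.univ

/-- The Fourier coefficient `μ̂(m) = ∫ exp(-2πimx) dμ(x)`. -/
def fourierCoeffMeasure (μ : ComplexMeasure Torus) (m : ℤ) : ℂ :=
  cintegral μ (fun x => fourier (-m) x)

/-- The projection `P_M μ(x) = ∑_{m=-M}^{M} μ̂(m) exp(2πimx)`. -/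
def proj (M : ℕ) (μ : ComplexMeasure Torus) (x : Torus) : ℂ :=
  ∑ m ∈ Finset.Icc (-(M : ℤ)) (M : ℤ), fourierCoeffMeasure μ m * fourier m x

/-- Minimum separation: distinct points of `S` are at distance at least `2 / M` on the torus. -/
def MinSeparation (M : ℕ) (S : Finset Torus) : Prop :=
  ∀ s ∈ S, ∀ t ∈ S, s ≠ t → 2 / (M : ℝ) ≤ dist s t

/-- Discrete measures `∑_{s ∈ S} a_s δ_s`, all `a_s ≠ 0`, whose support `S` satisfies the minimum
separation condition. -/
def IsSeparatedDiscrete (M : ℕ) (μ : ComplexMeasure Torus) : Prop :=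
  ∃ (S : Finset Torus) (a : Torus → ℂ), MinSeparation M S ∧ (∀ s ∈ S, a s ≠ 0) ∧
    μ = ∑ s ∈ S, VectorMeasure.dirac s (a s)

/-- `μ` is an `(ε, Λ_M)`-approximation of `μ₀`:
`‖μ‖ ≤ ‖μ₀‖ + 2ε` and `‖P_M(μ - μ₀)‖_{L²} ≤ 2ε`. -/
def IsApproximation (ε : ℝ≥0) (M : ℕ) (μ μ₀ : ComplexMeasure Torus) : Prop :=
  tvNorm μ ≤ tvNorm μ₀ + 2 * (ε : ℝ≥0∞) ∧
    eLpNorm (proj M (μ - μ₀)) 2 volume ≤ 2 * (ε : ℝ≥0∞)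

/-- `K` is differentiable at every point of the torus. -/
def TorusDifferentiable (K : Torus → ℂ) : Prop :=
  ∀ x : Torus, DifferentiableAt ℝ (fun t : ℝ => K (x + (t : Torus))) 0

/-- The derivative `K'` of a function on the torus. -/
def torusDeriv (K : Torus → ℂ) (x : Torus) : ℂ :=
  deriv (fun t : ℝ => K (x + (t : Torus))) 0

/-- The convolution `(K * ν)(x) = ∫ K(x - y) dν(y)`. -/
def conv (K : Torus → ℂ) (ν : ComplexMeasure Torus) (x : Torus) : ℂ :=
  cintegral ν (fun y => K (x - y))

end SuperResolution

end

/-!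
The proof is by duality. Let `S` be the support of `μ₀ = ∑ a_s δ_s`. Suppose that a trigonometric
polynomial `f` of degree at most `M` satisfies `f(s) = conj a_s / |a_s|` on `S` and `|f| ≤ 1`. Then
`∫ f dμ₀ = ‖μ₀‖`, and the two conditions on `μ` give `∫ (1 - |f|) d|μ| ≤ 4ε`, so that `μ` is
concentrated where `|f|` is close to `1`. If moreover `1 - |f|` grows quadratically, at scale `1/M`,
with the distance to `S`, choose a trigonometric polynomial `T` of degree at most `M` with the
values and the derivatives of `K(x - ·)` on `S`. By Taylor's formula `|K(x - ·) - T|` is at most a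
multiple of `1 - |f|`, hence has integral `O(ε)` against `|μ|` (and vanishes on `S`), while
`∫ T d(μ - μ₀) = O(ε) sup |T|` because `T` only sees `P_M (μ - μ₀)`.

Both `f` and `T` are combinations of translates to the points of `S` of the fourth power of the
Dirichlet kernel of order `N ≈ M/2`, and of this power multiplied by a sine. In the variable `N x`
on the circle of length `N` the points of `S` are `1`-separated, and the fourth-power decay of the
kernels makes the Hermite interpolation problem a small perturbation of the identity.
-/

noncomputable section

namespace SuperResolution

open Real

/-! ### Integration against complex measures -/

lemma integrable_of_continuous {X E : Type*} [TopologicalSpace X] [CompactSpace X]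
    [MeasurableSpace X] [OpensMeasurableSpace X] [NormedAddCommGroup E] (μ : Measure X)
    [IsFiniteMeasure μ] {f : X → E} (hf : Continuous f) : Integrable f μ :=
  hf.integrable_of_hasCompactSupport (HasCompactSupport.of_compactSpace f)

lemma norm_cintegral_le (μ : ComplexMeasure Torus) (f : Torus → ℂ) :
    ‖cintegral μ f‖ ≤ ∫ x, ‖f x‖ ∂μ.variation := by
  simpa only [cintegral, ContinuousLinearMap.opNorm_mul, one_mul] using
    VectorMeasure.norm_integral_le_integral_norm (μ := μ) (f := f)
      (B := ContinuousLinearMap.mul ℝ ℂ)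

lemma cintegral_smul (μ : ComplexMeasure Torus) (c : ℂ) (f : Torus → ℂ) :
    cintegral μ (c • f) = c * cintegral μ f :=
  setToFun_smul _ (fun _ _ _ => mul_assoc _ _ _) c f

lemma cintegral_zero (μ : ComplexMeasure Torus) : cintegral μ 0 = 0 := by
  simpa only [zero_smul, zero_mul] using cintegral_smul μ 0 0

lemma cintegral_add (μ : ComplexMeasure Torus) [IsFiniteMeasure μ.variation] {f g : Torus → ℂ}
    (hf : Continuous f) (hg : Continuous g) :
    cintegral μ (f + g) = cintegral μ f + cintegral μ g :=
  VectorMeasure.integral_add (integrable_of_continuous _ hf) (integrable_of_continuous _ hg)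

lemma cintegral_sub (μ : ComplexMeasure Torus) [IsFiniteMeasure μ.variation] {f g : Torus → ℂ}
    (hf : Continuous f) (hg : Continuous g) :
    cintegral μ (f - g) = cintegral μ f - cintegral μ g :=
  VectorMeasure.integral_sub (integrable_of_continuous _ hf) (integrable_of_continuous _ hg)

lemma cintegral_sub_measure (μ ν : ComplexMeasure Torus) [IsFiniteMeasure μ.variation]
    [IsFiniteMeasure ν.variation] {f : Torus → ℂ} (hf : Continuous f) :
    cintegral (μ - ν) f = cintegral μ f - cintegral ν f :=
  VectorMeasure.integral_sub_vectorMeasure (integrable_of_continuous _ hf)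
    (integrable_of_continuous _ hf)

lemma cintegral_sum_dirac (S : Finset Torus) (a : Torus → ℂ) {f : Torus → ℂ}
    (hf : Continuous f) :
    cintegral (∑ s ∈ S, VectorMeasure.dirac s (a s)) f = ∑ s ∈ S, f s * a s := by
  rw [cintegral, VectorMeasure.integral_finsetSum_vectorMeasure
    fun s _ => integrable_of_continuous _ hf]
  simp

lemma tvNorm_sum_dirac_le (S : Finset Torus) (a : Torus → ℂ) :
    tvNorm (∑ s ∈ S, VectorMeasure.dirac s (a s)) ≤ ENNReal.ofReal (∑ s ∈ S, ‖a s‖) := by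
  refine (VectorMeasure.variation_finsetSum_le S _ _).trans ?_
  rw [ENNReal.ofReal_sum_of_nonneg fun _ _ => norm_nonneg _]
  simp

/-! ### Trigonometric polynomials -/

/-- The space of trigonometric polynomials of degree at most `n`, as functions on the torus. -/
def trigPoly (n : ℕ) : Submodule ℂ (Torus → ℂ) :=
  Submodule.span ℂ ((fun (m : ℤ) (x : Torus) => fourier m x) '' {m | |m| ≤ n})

lemma fourier_mem_trigPoly {n : ℕ} {m : ℤ} (hm : |m| ≤ n) :
    (fun x : Torus => (fourier m x : ℂ)) ∈ trigPoly n :=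
  Submodule.subset_span ⟨m, hm, rfl⟩

lemma continuous_of_mem_trigPoly {n : ℕ} {f : Torus → ℂ} (hf : f ∈ trigPoly n) :
    Continuous f := by
  induction hf using Submodule.span_induction with
  | mem _ hg => obtain ⟨m, -, rfl⟩ := hg; exact (fourier m).continuous
  | zero => exact continuous_const
  | add _ _ _ _ hf hg => exact hf.add hg
  | smul c _ _ hf => exact hf.const_smul c

lemma trigPoly_mono {m n : ℕ} (h : m ≤ n) : trigPoly m ≤ trigPoly n :=
  Submodule.span_mono (Set.image_mono fun k (hk : |k| ≤ m) => hk.trans (by exact_mod_cast h))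

lemma mul_mem_trigPoly {m n : ℕ} {f g : Torus → ℂ} (hf : f ∈ trigPoly m) (hg : g ∈ trigPoly n) :
    f * g ∈ trigPoly (m + n) := by
  have h := Submodule.mul_mem_mul hf hg
  rw [trigPoly, trigPoly, Submodule.span_mul_span] at h
  refine Submodule.span_mono ?_ h
  rintro _ ⟨_, ⟨k, hk, rfl⟩, _, ⟨l, hl, rfl⟩, rfl⟩
  refine ⟨k + l, ?_, funext fun x => fourier_add⟩
  push_cast
  exact (abs_add_le k l).trans (add_le_add hk hl)

lemma fourier_sub_eq_mul (m : ℤ) (x s : Torus) :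
    (fourier m (x - s) : ℂ) = fourier m (-s) * fourier m x := by
  simp only [sub_eq_neg_add, fourier_apply, smul_add, AddCircle.toCircle_add, Circle.coe_mul]

lemma comp_sub_mem_trigPoly {n : ℕ} {f : Torus → ℂ} (hf : f ∈ trigPoly n) (s : Torus) :
    (fun x => f (x - s)) ∈ trigPoly n := by
  induction hf using Submodule.span_induction with
  | mem _ hg =>
    obtain ⟨m, hm, rfl⟩ := hg
    simp only [fourier_sub_eq_mul]
    exact Submodule.smul_mem _ _ (fourier_mem_trigPoly hm)
  | zero => exact Submodule.zero_mem _
  | add _ _ _ _ hf hg => exact Submodule.add_mem _ hf hg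
  | smul c _ _ hf => exact Submodule.smul_mem _ c hf

lemma continuous_proj (M : ℕ) (ν : ComplexMeasure Torus) : Continuous (proj M ν) :=
  continuous_finsetSum _ fun m _ => continuous_const.mul (fourier m).continuous

instance isProbabilityMeasure_volume : IsProbabilityMeasure (volume : Measure Torus) :=
  ⟨by simp [AddCircle.measure_univ]⟩

lemma integral_fourier (m : ℤ) : ∫ x : Torus, (fourier m x : ℂ) = if m = 0 then 1 else 0 := by
  have h := congrFun (fourierCoeff_fourier (T := (1 : ℝ)) m) 0
  simpa [fourierCoeff, AddCircle.integral_haarAddCircle, Pi.single_apply, eq_comm] using h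

lemma integral_fourier_mul_proj {M : ℕ} (ν : ComplexMeasure Torus) {m : ℤ} (hm : |m| ≤ M) :
    ∫ x : Torus, (fourier m x : ℂ) * proj M ν x = fourierCoeffMeasure ν (-m) := by
  have expand (x : Torus) : (fourier m x : ℂ) * proj M ν x
      = ∑ k ∈ Finset.Icc (-(M : ℤ)) M, fourierCoeffMeasure ν k * (fourier (m + k) x : ℂ) := by
    rw [proj, Finset.mul_sum]
    exact Finset.sum_congr rfl fun k _ => by rw [fourier_add, mul_left_comm]
  have mem : -m ∈ Finset.Icc (-(M : ℤ)) M := by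
    rw [abs_le] at hm
    simp only [Finset.mem_Icc]; omega
  simp_rw [expand]
  rw [integral_finsetSum _ fun k _ => (integrable_of_continuous volume
    (fourier (T := (1 : ℝ)) (m + k)).continuous).const_mul (fourierCoeffMeasure ν k)]
  simp_rw [integral_const_mul, integral_fourier, add_eq_zero_iff_neg_eq (a := m), mul_ite, mul_one,
    mul_zero]
  rw [Finset.sum_ite_eq, if_pos mem]

lemma cintegral_eq_integral_mul_proj {M : ℕ} (ν : ComplexMeasure Torus)
    [IsFiniteMeasure ν.variation] {T : Torus → ℂ} (hT : T ∈ trigPoly M) :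
    cintegral ν T = ∫ x, T x * proj M ν x := by
  induction hT using Submodule.span_induction with
  | mem _ hg =>
    obtain ⟨m, hm, rfl⟩ := hg
    rw [integral_fourier_mul_proj ν hm, fourierCoeffMeasure, neg_neg]
  | zero => simp [cintegral_zero]
  | add f g hf hg ihf ihg =>
    have hf := continuous_of_mem_trigPoly hf
    have hg := continuous_of_mem_trigPoly hg
    have hP := continuous_proj M ν
    simp only [cintegral_add ν hf hg, ihf, ihg, Pi.add_apply, add_mul]
    exact (integral_add (integrable_of_continuous volume (hf.mul hP))
      (integrable_of_continuous volume (hg.mul hP))).symm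
  | smul c f _ ih =>
    simp only [cintegral_smul, ih, ← integral_const_mul, Pi.smul_apply, smul_eq_mul, mul_assoc]

lemma integral_norm_proj_le {M : ℕ} {ν : ComplexMeasure Torus} {δ : ℝ≥0}
    (hδ : eLpNorm (proj M ν) 2 volume ≤ δ) : ∫ x, ‖proj M ν x‖ ≤ δ := by
  have hP := (continuous_proj M ν).aestronglyMeasurable (μ := volume)
  rw [integral_norm_eq_lintegral_enorm hP, ← eLpNorm_one_eq_lintegral_enorm]
  exact ENNReal.toReal_le_coe_of_le_coe
    ((eLpNorm_le_eLpNorm_of_exponent_le (by norm_num) hP).trans hδ)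

lemma norm_cintegral_trigPoly_le {M : ℕ} (ν : ComplexMeasure Torus)
    [IsFiniteMeasure ν.variation] {T : Torus → ℂ} (hT : T ∈ trigPoly M) {c : ℝ}
    (hc : ∀ x, ‖T x‖ ≤ c) {δ : ℝ≥0} (hδ : eLpNorm (proj M ν) 2 volume ≤ δ) :
    ‖cintegral ν T‖ ≤ c * δ := by
  have hP := continuous_proj M ν
  have hc0 : 0 ≤ c := (norm_nonneg _).trans (hc 0)
  rw [cintegral_eq_integral_mul_proj ν hT]
  calc ‖∫ x, T x * proj M ν x‖ ≤ ∫ x, ‖T x * proj M ν x‖ := norm_integral_le_integral_norm _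
    _ ≤ ∫ x, c * ‖proj M ν x‖ := by
      refine integral_mono (integrable_of_continuous _
        ((continuous_of_mem_trigPoly hT).mul hP).norm)
        (integrable_of_continuous _ (continuous_const.mul hP.norm)) fun x => ?_
      simp only [norm_mul]
      exact mul_le_mul_of_nonneg_right (hc x) (norm_nonneg _)
    _ = c * ∫ x, ‖proj M ν x‖ := integral_const_mul _ _
    _ ≤ c * δ := mul_le_mul_of_nonneg_left (integral_norm_proj_le hδ) hc0

/-! ### Error bound from a dual certificate -/

section Certificate

variable {M : ℕ} {ε : ℝ≥0} {S : Finset Torus} {a : Torus → ℂ} {μ μ₀ : ComplexMeasure Torus}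

lemma isFiniteMeasure_variation_sum_dirac (S : Finset Torus) (a : Torus → ℂ) :
    IsFiniteMeasure (VectorMeasure.variation (∑ s ∈ S, VectorMeasure.dirac s (a s))) :=
  ⟨(tvNorm_sum_dirac_le S a).trans_lt ENNReal.ofReal_lt_top⟩

lemma isFiniteMeasure_variation_sub (μ ν : ComplexMeasure Torus) [IsFiniteMeasure μ.variation]
    [IsFiniteMeasure ν.variation] : IsFiniteMeasure (μ - ν).variation :=
  isFiniteMeasure_of_le _ VectorMeasure.variation_sub_le

lemma IsApproximation.eLpNorm_proj_le (h : IsApproximation ε M μ μ₀) :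
    eLpNorm (proj M (μ - μ₀)) 2 volume ≤ ((2 * ε : ℝ≥0) : ℝ≥0∞) := by
  simpa using h.2

lemma IsApproximation.tvNorm_le
    (h : IsApproximation ε M μ (∑ s ∈ S, VectorMeasure.dirac s (a s))) :
    tvNorm μ ≤ ENNReal.ofReal (∑ s ∈ S, ‖a s‖ + 2 * ε) := by
  rw [ENNReal.ofReal_add (Finset.sum_nonneg fun _ _ => norm_nonneg _) (by positivity)]
  refine h.1.trans (add_le_add (tvNorm_sum_dirac_le S a) ?_)
  rw [ENNReal.ofReal_mul zero_le_two]
  simp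

lemma IsApproximation.isFiniteMeasure_variation
    (h : IsApproximation ε M μ (∑ s ∈ S, VectorMeasure.dirac s (a s))) :
    IsFiniteMeasure μ.variation :=
  ⟨h.tvNorm_le.trans_lt ENNReal.ofReal_lt_top⟩

lemma sum_norm_sub_le_integral_norm
    (h : IsApproximation ε M μ (∑ s ∈ S, VectorMeasure.dirac s (a s)))
    {f : Torus → ℂ} (hf : f ∈ trigPoly M) (hf1 : ∀ x, ‖f x‖ ≤ 1)
    (hfS : ∀ s ∈ S, f s * a s = ‖a s‖) :
    ∑ s ∈ S, ‖a s‖ - 2 * ε ≤ ∫ x, ‖f x‖ ∂μ.variation := by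
  have := isFiniteMeasure_variation_sum_dirac S a
  have := h.isFiniteMeasure_variation
  have := isFiniteMeasure_variation_sub μ (∑ s ∈ S, VectorMeasure.dirac s (a s))
  have hfc := continuous_of_mem_trigPoly hf
  have diff_le := norm_cintegral_trigPoly_le _ hf hf1 h.eLpNorm_proj_le
  rw [cintegral_sub_measure _ _ hfc, cintegral_sum_dirac S a hfc, Finset.sum_congr rfl hfS,
    ← Complex.ofReal_sum, norm_sub_rev] at diff_le
  have triangle := norm_sub_norm_le ((∑ s ∈ S, ‖a s‖ : ℝ) : ℂ) (cintegral μ f)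
  rw [Complex.norm_real, Real.norm_of_nonneg (Finset.sum_nonneg fun _ _ => norm_nonneg _)]
    at triangle
  push_cast at diff_le triangle
  linarith [norm_cintegral_le μ f]

lemma integral_one_sub_norm_le
    (h : IsApproximation ε M μ (∑ s ∈ S, VectorMeasure.dirac s (a s)))
    {f : Torus → ℂ} (hf : f ∈ trigPoly M) (hf1 : ∀ x, ‖f x‖ ≤ 1)
    (hfS : ∀ s ∈ S, f s * a s = ‖a s‖) :
    ∫ x, (1 - ‖f x‖) ∂μ.variation ≤ 4 * ε := by
  have := h.isFiniteMeasure_variation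
  have mass_le : μ.variation.real Set.univ ≤ ∑ s ∈ S, ‖a s‖ + 2 * ε :=
    ENNReal.toReal_le_of_le_ofReal (by positivity) h.tvNorm_le
  rw [integral_sub (integrable_const _)
    (integrable_of_continuous _ (continuous_of_mem_trigPoly hf).norm)]
  simp only [integral_const, smul_eq_mul, mul_one]
  linarith [sum_norm_sub_le_integral_norm h hf hf1 hfS]

theorem norm_cintegral_sub_le_of_certificate
    (h : IsApproximation ε M μ (∑ s ∈ S, VectorMeasure.dirac s (a s)))
    {f T φ : Torus → ℂ} (hf : f ∈ trigPoly M) (hf1 : ∀ x, ‖f x‖ ≤ 1)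
    (hfS : ∀ s ∈ S, f s * a s = ‖a s‖) (hT : T ∈ trigPoly M) {c d : ℝ}
    (hc : ∀ x, ‖T x‖ ≤ c) (hφ : Continuous φ) (hφS : ∀ s ∈ S, φ s = T s) (hd : 0 ≤ d)
    (hφT : ∀ x, ‖φ x - T x‖ ≤ d * (1 - ‖f x‖)) :
    ‖cintegral (μ - ∑ s ∈ S, VectorMeasure.dirac s (a s)) φ‖ ≤ (2 * c + 4 * d) * ε := by
  set μ₀ : ComplexMeasure Torus := ∑ s ∈ S, VectorMeasure.dirac s (a s) with hμ₀
  have : IsFiniteMeasure μ₀.variation := isFiniteMeasure_variation_sum_dirac S a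
  have := h.isFiniteMeasure_variation
  have := isFiniteMeasure_variation_sub μ μ₀
  have hfc := continuous_of_mem_trigPoly hf
  have hTc := continuous_of_mem_trigPoly hT
  have residual_le : ‖cintegral μ (φ - T)‖ ≤ d * (4 * ε) :=
    calc ‖cintegral μ (φ - T)‖ ≤ ∫ x, ‖(φ - T) x‖ ∂μ.variation := norm_cintegral_le μ _
      _ ≤ ∫ x, d * (1 - ‖f x‖) ∂μ.variation :=
        integral_mono (integrable_of_continuous _ (hφ.sub hTc).norm)
          (integrable_of_continuous _ (continuous_const.mul (continuous_const.sub hfc.norm))) hφT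
      _ = d * ∫ x, (1 - ‖f x‖) ∂μ.variation := integral_const_mul _ _
      _ ≤ _ := mul_le_mul_of_nonneg_left (integral_one_sub_norm_le h hf hf1 hfS) hd
  have residual_eq_zero : cintegral μ₀ (φ - T) = 0 := by
    rw [hμ₀, cintegral_sum_dirac S a (hφ.sub hTc)]
    exact Finset.sum_eq_zero fun s hs => by simp [hφS s hs]
  have split : cintegral (μ - μ₀) φ = cintegral μ (φ - T) + cintegral (μ - μ₀) T := by
    rw [← sub_zero (cintegral μ _), ← residual_eq_zero, ← cintegral_sub_measure _ _ (hφ.sub hTc),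
      cintegral_sub _ hφ hTc, sub_add_cancel]
  have poly_le := norm_cintegral_trigPoly_le (μ - μ₀) hT hc h.eLpNorm_proj_le
  push_cast at poly_le
  rw [split]
  linarith [norm_add_le (cintegral μ (φ - T)) (cintegral (μ - μ₀) T)]

end Certificate

/-! ### The normalized Dirichlet kernel -/

/-- The `k`-th frequency `π (2k + 1 - N) / N` of the normalized Dirichlet kernel of order `N`; the
frequencies are equally spaced and symmetric about `0`. -/
def dirichletFreq (N k : ℕ) : ℝ := π * (2 * k + 1 - N) / N

/-- The normalized Dirichlet kernel `sin (π t) / (N sin (π t / N))`, on a circle of length `N`. It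
is written as a sum of cosines so that it is smooth also at the zeros of the denominator. -/
def dirichlet (N : ℕ) (t : ℝ) : ℝ := (∑ k ∈ Finset.range N, cos (dirichletFreq N k * t)) / N

/-- The derivative of `dirichlet N`. -/
def dirichletDeriv (N : ℕ) (t : ℝ) : ℝ :=
  (∑ k ∈ Finset.range N, -(dirichletFreq N k * sin (dirichletFreq N k * t))) / N

/-- The second derivative of `dirichlet N`. -/
def dirichletDeriv₂ (N : ℕ) (t : ℝ) : ℝ :=
  (∑ k ∈ Finset.range N, -(dirichletFreq N k ^ 2 * cos (dirichletFreq N k * t))) / N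

/-- The function `N sin (π t / N)`, whose absolute value is `π` times the length of the chord
between points at distance `t` on a circle of circumference `N`. -/
def chord (N : ℕ) (t : ℝ) : ℝ := N * sin (π * t / N)

/-- The cosine `cos (π t / N)`, which is the derivative of `chord N` divided by `π`. -/
def chordCos (N : ℕ) (t : ℝ) : ℝ := cos (π * t / N)

lemma hasDerivAt_dirichlet (N : ℕ) (t : ℝ) :
    HasDerivAt (dirichlet N) (dirichletDeriv N t) t := by
  refine HasDerivAt.div_const (HasDerivAt.fun_sum fun k _ => ?_) _
  simpa [mul_comm] using ((hasDerivAt_id t).const_mul (dirichletFreq N k)).cos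

lemma hasDerivAt_dirichletDeriv (N : ℕ) (t : ℝ) :
    HasDerivAt (dirichletDeriv N) (dirichletDeriv₂ N t) t := by
  refine HasDerivAt.div_const (HasDerivAt.fun_sum fun k _ => ?_) _
  refine (((hasDerivAt_id t).const_mul (dirichletFreq N k)).sin.const_mul
    (dirichletFreq N k)).neg.congr_deriv ?_
  simp only [id]; ring

lemma hasDerivAt_chord {N : ℕ} (hN : N ≠ 0) (t : ℝ) :
    HasDerivAt (chord N) (π * chordCos N t) t := by
  refine ((((hasDerivAt_id t).const_mul π).div_const (N : ℝ)).sin.const_mul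
    (N : ℝ)).congr_deriv ?_
  simp only [chordCos, id]
  field_simp

lemma hasDerivAt_chordCos {N : ℕ} (hN : N ≠ 0) (t : ℝ) :
    HasDerivAt (chordCos N) (-(π / N ^ 2 * chord N t)) t := by
  refine (((hasDerivAt_id t).const_mul π).div_const (N : ℝ)).cos.congr_deriv ?_
  simp only [chord, id]
  field_simp

lemma dirichlet_mul_chord {N : ℕ} (hN : N ≠ 0) (t : ℝ) :
    dirichlet N t * chord N t = sin (π * t) := by
  let F : ℕ → ℝ := fun k => sin (π * (2 * k - N) / N * t) / 2
  have telescope (k : ℕ) : cos (dirichletFreq N k * t) * sin (π * t / N) = F (k + 1) - F k := by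
    have upper : π * (2 * (k + 1 : ℕ) - N) / N * t = dirichletFreq N k * t + π * t / N := by
      simp only [dirichletFreq]; push_cast; field_simp; ring
    have lower : π * (2 * k - N) / N * t = dirichletFreq N k * t - π * t / N := by
      simp only [dirichletFreq]; field_simp; ring
    simp only [F]
    rw [upper, lower, sin_add, sin_sub]; ring
  have top : F N = sin (π * t) / 2 := by
    have : π * (2 * (N : ℝ) - N) / N * t = π * t := by field_simp; ring
    simp only [F, this]
  have bottom : F 0 = -(sin (π * t) / 2) := by
    have : π * (2 * ((0 : ℕ) : ℝ) - N) / N * t = -(π * t) := by push_cast; field_simp; ring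
    simp only [F, this, sin_neg, neg_div]
  calc dirichlet N t * chord N t
      = ∑ k ∈ Finset.range N, cos (dirichletFreq N k * t) * sin (π * t / N) := by
        rw [dirichlet, chord, ← Finset.sum_mul, ← mul_assoc,
          div_mul_cancel₀ _ (by exact_mod_cast hN)]
    _ = F N - F 0 := by rw [Finset.sum_congr rfl fun k _ => telescope k, Finset.sum_range_sub F]
    _ = sin (π * t) := by rw [top, bottom]; ring

lemma dirichletDeriv_mul_chord {N : ℕ} (hN : N ≠ 0) (t : ℝ) :
    dirichletDeriv N t * chord N t + dirichlet N t * (π * chordCos N t) = π * cos (π * t) := by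
  have lhs := (hasDerivAt_dirichlet N t).mul (hasDerivAt_chord hN t)
  rw [show dirichlet N * chord N = fun t => sin (π * t) from
    funext (dirichlet_mul_chord hN)] at lhs
  rw [lhs.unique ((hasDerivAt_id t).const_mul π).sin, mul_one, mul_comm, id]

lemma dirichletDeriv₂_mul_chord {N : ℕ} (hN : N ≠ 0) (t : ℝ) :
    dirichletDeriv₂ N t * chord N t + 2 * dirichletDeriv N t * (π * chordCos N t)
      - dirichlet N t * (π ^ 2 / N ^ 2 * chord N t) = -(π ^ 2 * sin (π * t)) := by
  have lhs := ((hasDerivAt_dirichletDeriv N t).mul (hasDerivAt_chord hN t)).add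
    ((hasDerivAt_dirichlet N t).mul ((hasDerivAt_chordCos hN t).const_mul π))
  rw [show dirichletDeriv N * chord N + dirichlet N * (fun y => π * chordCos N y)
    = fun t => π * cos (π * t) from funext (dirichletDeriv_mul_chord hN)] at lhs
  have eq := lhs.unique (((hasDerivAt_id t).const_mul π).cos.const_mul π)
  simp only [id, mul_one] at eq
  linear_combination eq

lemma abs_dirichletFreq_le {N k : ℕ} (hk : k < N) : |dirichletFreq N k| ≤ π := by
  have hN : (0 : ℝ) < N := by exact_mod_cast (Nat.zero_le k).trans_lt hk
  have hk' : (k : ℝ) + 1 ≤ N := by exact_mod_cast hk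
  rw [dirichletFreq, abs_div, abs_mul, abs_of_pos pi_pos, abs_of_pos hN, div_le_iff₀ hN]
  refine mul_le_mul_of_nonneg_left ?_ pi_pos.le
  rw [abs_le]; constructor <;> linarith

lemma abs_sum_range_div_le {N : ℕ} {f : ℕ → ℝ} {c : ℝ} (hc : 0 ≤ c)
    (h : ∀ k < N, |f k| ≤ c) : |(∑ k ∈ Finset.range N, f k) / N| ≤ c := by
  rw [abs_div, Nat.abs_cast]
  refine div_le_of_le_mul₀ N.cast_nonneg hc ((Finset.abs_sum_le_sum_abs _ _).trans ?_)
  refine (Finset.sum_le_card_nsmul _ _ c fun k hk => h k (Finset.mem_range.1 hk)).trans_eq ?_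
  simp [mul_comm]

lemma abs_dirichlet_le (N : ℕ) (t : ℝ) : |dirichlet N t| ≤ 1 :=
  abs_sum_range_div_le zero_le_one fun _ _ => abs_cos_le_one _

lemma abs_dirichletDeriv_le (N : ℕ) (t : ℝ) : |dirichletDeriv N t| ≤ π := by
  refine abs_sum_range_div_le pi_pos.le fun k hk => ?_
  rw [abs_neg, abs_mul]
  exact (mul_le_of_le_one_right (abs_nonneg _) (abs_sin_le_one _)).trans (abs_dirichletFreq_le hk)

lemma abs_dirichletDeriv₂_le (N : ℕ) (t : ℝ) : |dirichletDeriv₂ N t| ≤ π ^ 2 := by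
  refine abs_sum_range_div_le (by positivity) fun k hk => ?_
  rw [abs_neg, abs_mul, abs_pow]
  exact (mul_le_of_le_one_right (by positivity) (abs_cos_le_one _)).trans
    (pow_le_pow_left₀ (abs_nonneg _) (abs_dirichletFreq_le hk) 2)

lemma dirichlet_zero {N : ℕ} (hN : N ≠ 0) : dirichlet N 0 = 1 := by
  simp [dirichlet, hN]

lemma dirichletDeriv_zero (N : ℕ) : dirichletDeriv N 0 = 0 := by simp [dirichletDeriv]

lemma dirichlet_neg (N : ℕ) (t : ℝ) : dirichlet N (-t) = dirichlet N t := by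
  simp [dirichlet]

lemma dirichlet_nonneg {N : ℕ} {t : ℝ} (ht : |t| ≤ 1 / 2) : 0 ≤ dirichlet N t := by
  refine div_nonneg (Finset.sum_nonneg fun k hk => ?_) N.cast_nonneg
  refine cos_nonneg_of_mem_Icc (abs_le.1 ?_)
  calc |dirichletFreq N k * t| = |dirichletFreq N k| * |t| := abs_mul _ _
    _ ≤ π * (1 / 2) := mul_le_mul
      (abs_dirichletFreq_le (Finset.mem_range.1 hk)) ht (abs_nonneg _) pi_pos.le
    _ = π / 2 := by ring

lemma dirichlet_antitone {N : ℕ} {s t : ℝ} (hs : 0 ≤ s) (hst : s ≤ t) (ht : t ≤ 1) :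
    dirichlet N t ≤ dirichlet N s := by
  refine div_le_div_of_nonneg_right (Finset.sum_le_sum fun k hk => ?_) N.cast_nonneg
  have freq_le := abs_dirichletFreq_le (Finset.mem_range.1 hk)
  rw [← cos_abs (_ * t), ← cos_abs (_ * s), abs_mul, abs_mul, abs_of_nonneg hs,
    abs_of_nonneg (hs.trans hst)]
  refine cos_le_cos_of_nonneg_of_le_pi (by positivity) ?_
    (mul_le_mul_of_nonneg_left hst (abs_nonneg _))
  exact (mul_le_mul freq_le ht (hs.trans hst) pi_pos.le).trans_eq (mul_one _)

/-! ### The Jackson kernel and its odd companion -/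

/-- The Jackson kernel `D⁴`, the fourth power of the normalized Dirichlet kernel. It is used to
prescribe values at the nodes: it equals `1` with zero derivative at `0` and decays fast. -/
def jackson (N : ℕ) (t : ℝ) : ℝ := dirichlet N t ^ 4

/-- The derivative of `jackson N`. -/
def jacksonDeriv (N : ℕ) (t : ℝ) : ℝ := 4 * dirichlet N t ^ 3 * dirichletDeriv N t

/-- The second derivative of `jackson N`. -/
def jacksonDeriv₂ (N : ℕ) (t : ℝ) : ℝ :=
  12 * dirichlet N t ^ 2 * dirichletDeriv N t ^ 2 + 4 * dirichlet N t ^ 3 * dirichletDeriv₂ N t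

/-- The function `N sin (2 π t / N) / (2 π)`, the `N`-periodic substitute for `t` near `0`. -/
def sineRamp (N : ℕ) (t : ℝ) : ℝ := chord N t * chordCos N t / π

/-- The derivative of `sineRamp N`. -/
def sineRampDeriv (N : ℕ) (t : ℝ) : ℝ := cos (2 * (π * t / N))

/-- The second derivative of `sineRamp N`. -/
def sineRampDeriv₂ (N : ℕ) (t : ℝ) : ℝ := -(4 * π ^ 2 / N ^ 2) * sineRamp N t

/-- The odd kernel `sineRamp N * jackson N`. It is used to prescribe derivatives at the nodes: it
vanishes with derivative `1` at `0`. -/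
def oddJackson (N : ℕ) (t : ℝ) : ℝ := sineRamp N t * jackson N t

/-- The derivative of `oddJackson N`. -/
def oddJacksonDeriv (N : ℕ) (t : ℝ) : ℝ :=
  sineRampDeriv N t * jackson N t + sineRamp N t * jacksonDeriv N t

/-- The second derivative of `oddJackson N`. -/
def oddJacksonDeriv₂ (N : ℕ) (t : ℝ) : ℝ :=
  sineRampDeriv₂ N t * jackson N t + 2 * sineRampDeriv N t * jacksonDeriv N t
    + sineRamp N t * jacksonDeriv₂ N t

lemma hasDerivAt_jackson (N : ℕ) (t : ℝ) : HasDerivAt (jackson N) (jacksonDeriv N t) t := by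
  simpa [jacksonDeriv] using! (hasDerivAt_dirichlet N t).pow 4

lemma hasDerivAt_jacksonDeriv (N : ℕ) (t : ℝ) :
    HasDerivAt (jacksonDeriv N) (jacksonDeriv₂ N t) t := by
  refine ((((hasDerivAt_dirichlet N t).pow 3).const_mul 4).mul
    (hasDerivAt_dirichletDeriv N t)).congr_deriv ?_
  simp only [jacksonDeriv₂, Pi.pow_apply, Nat.cast_ofNat]; ring

lemma hasDerivAt_sineRamp {N : ℕ} (hN : N ≠ 0) (t : ℝ) :
    HasDerivAt (sineRamp N) (sineRampDeriv N t) t := by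
  refine (((hasDerivAt_chord hN t).mul (hasDerivAt_chordCos hN t)).div_const π).congr_deriv ?_
  simp only [sineRampDeriv, chord, chordCos, cos_two_mul']
  field_simp
  ring

lemma hasDerivAt_sineRampDeriv {N : ℕ} (hN : N ≠ 0) (t : ℝ) :
    HasDerivAt (sineRampDeriv N) (sineRampDeriv₂ N t) t := by
  refine ((((hasDerivAt_id t).const_mul π).div_const (N : ℝ)).const_mul 2).cos.congr_deriv ?_
  simp only [sineRampDeriv₂, sineRamp, chord, chordCos, id, sin_two_mul]
  field_simp
  ring

lemma hasDerivAt_oddJackson {N : ℕ} (hN : N ≠ 0) (t : ℝ) :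
    HasDerivAt (oddJackson N) (oddJacksonDeriv N t) t :=
  (hasDerivAt_sineRamp hN t).mul (hasDerivAt_jackson N t)

lemma hasDerivAt_oddJacksonDeriv {N : ℕ} (hN : N ≠ 0) (t : ℝ) :
    HasDerivAt (oddJacksonDeriv N) (oddJacksonDeriv₂ N t) t := by
  refine (((hasDerivAt_sineRampDeriv hN t).mul (hasDerivAt_jackson N t)).add
    ((hasDerivAt_sineRamp hN t).mul (hasDerivAt_jacksonDeriv N t))).congr_deriv ?_
  simp only [oddJacksonDeriv₂]; ring

lemma jackson_zero {N : ℕ} (hN : N ≠ 0) : jackson N 0 = 1 := by simp [jackson, dirichlet_zero hN]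

lemma jacksonDeriv_zero (N : ℕ) : jacksonDeriv N 0 = 0 := by
  simp [jacksonDeriv, dirichletDeriv_zero]

lemma sineRamp_zero (N : ℕ) : sineRamp N 0 = 0 := by simp [sineRamp, chord]

lemma oddJackson_zero (N : ℕ) : oddJackson N 0 = 0 := by simp [oddJackson, sineRamp_zero]

lemma oddJacksonDeriv_zero {N : ℕ} (hN : N ≠ 0) : oddJacksonDeriv N 0 = 1 := by
  simp [oddJacksonDeriv, sineRampDeriv, jackson_zero hN, sineRamp_zero]

lemma jackson_nonneg (N : ℕ) (t : ℝ) : 0 ≤ jackson N t := by rw [jackson]; positivity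

lemma jackson_le_one (N : ℕ) (t : ℝ) : jackson N t ≤ 1 := by
  rw [jackson, ← Even.pow_abs (by decide)]
  exact pow_le_one₀ (abs_nonneg _) (abs_dirichlet_le N t)

lemma abs_jacksonDeriv_le (N : ℕ) (t : ℝ) : |jacksonDeriv N t| ≤ 4 * π := by
  have cube_le := pow_le_one₀ (n := 3) (abs_nonneg _) (abs_dirichlet_le N t)
  rw [jacksonDeriv, abs_mul, abs_mul, abs_pow, abs_of_pos (four_pos (α := ℝ))]
  exact mul_le_mul (by linarith) (abs_dirichletDeriv_le N t) (abs_nonneg _) (by norm_num)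

lemma abs_jacksonDeriv₂_le (N : ℕ) (t : ℝ) : |jacksonDeriv₂ N t| ≤ 16 * π ^ 2 := by
  have sq_le := pow_le_one₀ (n := 2) (abs_nonneg _) (abs_dirichlet_le N t)
  have cube_le := pow_le_one₀ (n := 3) (abs_nonneg _) (abs_dirichlet_le N t)
  have deriv_sq_le := pow_le_pow_left₀ (abs_nonneg _) (abs_dirichletDeriv_le N t) 2
  have first_le := mul_le_mul sq_le deriv_sq_le (by positivity) zero_le_one
  have second_le := mul_le_mul cube_le (abs_dirichletDeriv₂_le N t) (abs_nonneg _) zero_le_one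
  rw [jacksonDeriv₂]
  refine (abs_add_le _ _).trans ?_
  simp only [abs_mul, abs_pow, Nat.abs_ofNat]
  linarith

lemma abs_chordCos_le (N : ℕ) (t : ℝ) : |chordCos N t| ≤ 1 := abs_cos_le_one _

lemma abs_sineRamp_le (N : ℕ) (t : ℝ) : |sineRamp N t| ≤ |chord N t| / π := by
  rw [sineRamp, abs_div, abs_mul, abs_of_pos pi_pos]
  exact div_le_div_of_nonneg_right
    (mul_le_of_le_one_right (abs_nonneg _) (abs_chordCos_le N t)) pi_pos.le

lemma abs_sineRampDeriv_le (N : ℕ) (t : ℝ) : |sineRampDeriv N t| ≤ 1 := abs_cos_le_one _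

lemma abs_sineRampDeriv₂_le {N : ℕ} (hN : 64 ≤ N) (t : ℝ) :
    |sineRampDeriv₂ N t| ≤ 1 / 100 * |sineRamp N t| := by
  have hN' : (64 : ℝ) ≤ N := by exact_mod_cast hN
  rw [sineRampDeriv₂, abs_mul, abs_neg, abs_of_nonneg (by positivity)]
  refine mul_le_mul_of_nonneg_right ?_ (abs_nonneg _)
  rw [div_le_iff₀ (by positivity)]
  nlinarith [pi_lt_d2, pi_pos]

/-! ### Decay of the kernels -/

lemma abs_sin_cube_mul_cos_le (θ : ℝ) : |sin θ ^ 3 * cos θ| ≤ 1 / 3 := by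
  refine abs_le_of_sq_le_sq ?_ (by norm_num)
  set a := sin θ ^ 2
  have hcos : cos θ ^ 2 = 1 - a := by linarith [sin_sq_add_cos_sq θ]
  have : 0 ≤ a := sq_nonneg _
  calc (sin θ ^ 3 * cos θ) ^ 2 = a ^ 3 * (1 - a) := by rw [← hcos]; ring
    _ ≤ (1 / 3) ^ 2 := by
      nlinarith [mul_nonneg (sq_nonneg (a - 3 / 4)) (by positivity : 0 ≤ a ^ 2 + a / 2 + 3 / 16)]

lemma abs_sin_sq_mul_sub_le (θ : ℝ) {κ : ℝ} (hκ0 : 0 ≤ κ) (hκ1 : κ ≤ 1) :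
    |sin θ ^ 2 * (3 * cos θ ^ 2 - κ * sin θ ^ 2)| ≤ 1 := by
  rw [show cos θ ^ 2 = 1 - sin θ ^ 2 by linarith [sin_sq_add_cos_sq θ]]
  have ha0 : 0 ≤ sin θ ^ 2 := sq_nonneg _
  have ha1 : sin θ ^ 2 ≤ 1 := sin_sq_le_one _
  set a := sin θ ^ 2
  have h0 : 0 ≤ κ * (a * a) := by positivity
  have h1 : κ * (a * a) ≤ a * a := mul_le_of_le_one_left (by positivity) hκ1
  rw [abs_le]; constructor <;> nlinarith [sq_nonneg (a - 1 / 2)]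

section Decay

variable {N : ℕ} {t : ℝ}

lemma dirichlet_eq (hN : N ≠ 0) (h : chord N t ≠ 0) :
    dirichlet N t = sin (π * t) * (chord N t)⁻¹ := by
  rw [← dirichlet_mul_chord hN, mul_inv_cancel_right₀ h]

lemma dirichletDeriv_eq (hN : N ≠ 0) (h : chord N t ≠ 0) :
    dirichletDeriv N t = π * (cos (π * t)
      - chordCos N t * sin (π * t) * (chord N t)⁻¹) * (chord N t)⁻¹ := by
  have e := dirichletDeriv_mul_chord hN t
  rw [dirichlet_eq hN h] at e
  field_simp at e ⊢
  linear_combination e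

lemma dirichletDeriv₂_eq (hN : N ≠ 0) (h : chord N t ≠ 0) :
    dirichletDeriv₂ N t = -(2 * π * chordCos N t * dirichletDeriv N t * (chord N t)⁻¹)
      - π ^ 2 * (1 - 1 / N ^ 2) * dirichlet N t := by
  have e := dirichletDeriv₂_mul_chord hN t
  rw [← dirichlet_mul_chord hN] at e
  rw [← mul_inv_cancel_right₀ h (dirichletDeriv₂ N t)]
  linear_combination (chord N t)⁻¹ * e +
    (-π ^ 2 * (1 - 1 / N ^ 2) * dirichlet N t) * mul_inv_cancel₀ h

lemma jacksonDeriv_eq (hN : N ≠ 0) (h : chord N t ≠ 0) :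
    jacksonDeriv N t = 4 * π * (sin (π * t) ^ 3 * cos (π * t)
      - chordCos N t * sin (π * t) ^ 4 * (chord N t)⁻¹) * (chord N t)⁻¹ ^ 4 := by
  rw [jacksonDeriv, dirichlet_eq hN h, dirichletDeriv_eq hN h]; ring

lemma jacksonDeriv₂_eq (hN : N ≠ 0) (h : chord N t ≠ 0) :
    jacksonDeriv₂ N t = 4 * π ^ 2 *
      (sin (π * t) ^ 2 * (3 * cos (π * t) ^ 2 - (1 - 1 / N ^ 2) * sin (π * t) ^ 2)
        - 8 * chordCos N t * (sin (π * t) ^ 3 * cos (π * t)) * (chord N t)⁻¹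
        + 5 * chordCos N t ^ 2 * sin (π * t) ^ 4 * (chord N t)⁻¹ ^ 2)
      * (chord N t)⁻¹ ^ 4 := by
  rw [jacksonDeriv₂, dirichletDeriv₂_eq hN h, dirichletDeriv_eq hN h, dirichlet_eq hN h]; ring

lemma jackson_le_inv_chord (hN : N ≠ 0) (h : chord N t ≠ 0) :
    jackson N t ≤ |chord N t|⁻¹ ^ 4 := by
  rw [jackson, ← Even.pow_abs (by decide), dirichlet_eq hN h, abs_mul, abs_inv]
  exact pow_le_pow_left₀ (by positivity)
    (mul_le_of_le_one_left (by positivity) (abs_sin_le_one _)) 4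

lemma abs_jacksonDeriv_le_inv_chord (hN : N ≠ 0) (h : chord N t ≠ 0) :
    |jacksonDeriv N t| ≤ 4 * π * (1 / 3 + |chord N t|⁻¹) * |chord N t|⁻¹ ^ 4 := by
  rw [jacksonDeriv_eq hN h, abs_mul, abs_mul, abs_pow, abs_inv, abs_of_pos (by positivity)]
  refine mul_le_mul_of_nonneg_right (mul_le_mul_of_nonneg_left ?_ (by positivity))
    (by positivity)
  refine (abs_sub _ _).trans (add_le_add (abs_sin_cube_mul_cos_le _) ?_)
  rw [abs_mul, abs_mul, abs_inv, abs_pow]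
  refine mul_le_of_le_one_left (by positivity) ?_
  exact mul_le_one₀ (abs_chordCos_le N t) (by positivity)
    (pow_le_one₀ (abs_nonneg _) (abs_sin_le_one _))

lemma abs_jacksonDeriv₂_le_inv_chord (hN : N ≠ 0) (h : chord N t ≠ 0) :
    |jacksonDeriv₂ N t| ≤ 4 * π ^ 2 * (1 + 8 / 3 * |chord N t|⁻¹ + 5 * |chord N t|⁻¹ ^ 2)
      * |chord N t|⁻¹ ^ 4 := by
  have hcos := abs_chordCos_le N t
  have leading_le := abs_sin_sq_mul_sub_le (π * t) (κ := 1 - 1 / N ^ 2)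
    (sub_nonneg.2 (by rw [one_div]; exact_mod_cast Nat.cast_inv_le_one (α := ℝ) (N ^ 2)))
    (sub_le_self _ (by positivity))
  have middle_le := mul_le_mul hcos (abs_sin_cube_mul_cos_le (π * t)) (abs_nonneg _) zero_le_one
  have last_le := mul_le_mul (pow_le_one₀ (n := 2) (abs_nonneg _) hcos)
    (pow_le_one₀ (n := 4) (abs_nonneg _) (abs_sin_le_one (π * t))) (by positivity) zero_le_one
  rw [jacksonDeriv₂_eq hN h, abs_mul, abs_mul, abs_pow, abs_inv, abs_of_pos (by positivity)]
  refine mul_le_mul_of_nonneg_right (mul_le_mul_of_nonneg_left ?_ (by positivity))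
    (by positivity)
  refine (abs_add_le _ _).trans (add_le_add ((abs_sub _ _).trans (add_le_add leading_le ?_)) ?_)
  · rw [abs_mul, abs_mul, abs_mul, abs_inv, Nat.abs_ofNat]
    exact mul_le_mul_of_nonneg_right (by linarith) (by positivity)
  · rw [abs_mul, abs_mul, abs_mul, abs_pow, abs_pow, abs_pow, abs_inv, Nat.abs_ofNat]
    exact mul_le_mul_of_nonneg_right (by linarith) (by positivity)

lemma abs_sineRamp_mul_le (h : chord N t ≠ 0) {c u : ℝ} (hu : |u| ≤ c * |chord N t|⁻¹ ^ 4) :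
    |sineRamp N t * u| ≤ c / π * |chord N t|⁻¹ ^ 3 := by
  rw [abs_mul]
  refine (mul_le_mul (abs_sineRamp_le N t) hu (abs_nonneg _) (by positivity)).trans_eq ?_
  have : |chord N t| ≠ 0 := abs_ne_zero.2 h
  field_simp

lemma abs_oddJackson_le_inv_chord (hN : N ≠ 0) (h : chord N t ≠ 0) :
    |oddJackson N t| ≤ 1 / π * |chord N t|⁻¹ ^ 3 := by
  refine abs_sineRamp_mul_le h ?_
  rw [abs_of_nonneg (jackson_nonneg N t), one_mul]
  exact jackson_le_inv_chord hN h

lemma abs_oddJacksonDeriv_le_inv_chord (hN : N ≠ 0) (h : chord N t ≠ 0) :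
    |oddJacksonDeriv N t|
      ≤ |chord N t|⁻¹ ^ 4 + 4 * (1 / 3 + |chord N t|⁻¹) * |chord N t|⁻¹ ^ 3 := by
  refine (abs_add_le _ _).trans (add_le_add ?_ ?_)
  · rw [abs_mul, abs_of_nonneg (jackson_nonneg N t)]
    exact (mul_le_of_le_one_left (jackson_nonneg N t) (abs_sineRampDeriv_le N t)).trans
      (jackson_le_inv_chord hN h)
  · refine (abs_sineRamp_mul_le h (abs_jacksonDeriv_le_inv_chord hN h)).trans_eq ?_
    field_simp

lemma abs_oddJacksonDeriv₂_le_inv_chord (hN : 64 ≤ N) (h : chord N t ≠ 0) :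
    |oddJacksonDeriv₂ N t| ≤ 1 / 100 * (1 / π * |chord N t|⁻¹ ^ 3)
      + 8 * π * (1 / 3 + |chord N t|⁻¹) * |chord N t|⁻¹ ^ 4
      + 4 * π * (1 + 8 / 3 * |chord N t|⁻¹ + 5 * |chord N t|⁻¹ ^ 2)
        * |chord N t|⁻¹ ^ 3 := by
  have hN0 : N ≠ 0 := by omega
  refine (abs_add_le _ _).trans (add_le_add ((abs_add_le _ _).trans (add_le_add ?_ ?_)) ?_)
  · calc |sineRampDeriv₂ N t * jackson N t|
        ≤ 1 / 100 * |sineRamp N t| * |jackson N t| := by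
          rw [abs_mul]
          exact mul_le_mul_of_nonneg_right (abs_sineRampDeriv₂_le hN t) (abs_nonneg _)
      _ = 1 / 100 * |oddJackson N t| := by rw [oddJackson, abs_mul]; ring
      _ ≤ _ := mul_le_mul_of_nonneg_left (abs_oddJackson_le_inv_chord hN0 h) (by norm_num)
  · rw [abs_mul, abs_mul, Nat.abs_ofNat]
    linarith [mul_le_mul (abs_sineRampDeriv_le N t) (abs_jacksonDeriv_le_inv_chord hN0 h)
      (abs_nonneg _) zero_le_one]
  · refine (abs_sineRamp_mul_le h (abs_jacksonDeriv₂_le_inv_chord hN0 h)).trans_eq ?_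
    field_simp

end Decay

/-! ### The kernels near the origin -/

lemma chord_neg (N : ℕ) (t : ℝ) : chord N (-t) = -chord N t := by
  simp [chord, neg_div]

lemma sineRamp_neg (N : ℕ) (t : ℝ) : sineRamp N (-t) = -sineRamp N t := by
  simp [sineRamp, chord_neg, chordCos, neg_div]

lemma le_chord_of_nonneg {N : ℕ} (hN : 64 ≤ N) {s : ℝ} (hs : 0 ≤ s) :
    π * s * (1 - (π * s) ^ 2 / 24576) ≤ chord N s := by
  have hN' : (64 : ℝ) ≤ N := by exact_mod_cast hN
  have hN0 : (0 : ℝ) < N := by linarith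
  have taylor : π * s - (π * s) ^ 3 / (6 * N ^ 2) ≤ chord N s := by
    calc _ = N * (π * s / N - (π * s / N) ^ 3 / 6) := by field_simp
      _ ≤ _ := mul_le_mul_of_nonneg_left (sin_ge_sub_cube (by positivity)) hN0.le
  have cubic_le : (π * s) ^ 3 / (6 * N ^ 2) ≤ (π * s) ^ 3 / 24576 := by
    apply div_le_div_of_nonneg_left (by positivity) (by norm_num)
    nlinarith
  linarith

lemma dirichlet_mul_le {N : ℕ} (hN : 64 ≤ N) {s : ℝ} (hs : 0 < s) (hs1 : π * s ≤ 1) :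
    dirichlet N s * (1 - (π * s) ^ 2 / 24576) ≤ 1 - (π * s) ^ 2 / 6 + (π * s) ^ 4 / 100 := by
  have hD : 0 ≤ dirichlet N s := by
    refine dirichlet_nonneg ?_
    rw [abs_of_pos hs]
    nlinarith [pi_gt_three]
  have sin_ge := mul_le_mul_of_nonneg_left (le_chord_of_nonneg hN hs.le) hD
  rw [dirichlet_mul_chord (by omega)] at sin_ge
  set y := π * s
  have hy : 0 < y := mul_pos pi_pos hs
  have sin_le := (abs_le.1 (sin_bound (x := y) (by rwa [abs_of_pos hy]))).2
  rw [abs_of_pos hy] at sin_le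
  refine le_of_mul_le_mul_left ?_ hy
  nlinarith

lemma dirichlet_le_one_sub_sq {N : ℕ} (hN : 64 ≤ N) {s : ℝ} (hs : 0 ≤ s) (hs1 : π * s ≤ 0.63) :
    dirichlet N s ≤ 1 - 0.1625 * (π * s) ^ 2 := by
  rcases hs.eq_or_lt with rfl | hs
  · simp [dirichlet_zero (by omega : N ≠ 0)]
  have h := dirichlet_mul_le hN hs (by linarith)
  rw [show (π * s) ^ 4 = ((π * s) ^ 2) ^ 2 by ring] at h
  have ha : 0 < (π * s) ^ 2 := by positivity
  have ha1 : (π * s) ^ 2 ≤ 0.397 := by nlinarith [mul_pos pi_pos hs]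
  set a := (π * s) ^ 2
  refine le_of_mul_le_mul_right (h.trans ?_) (by linarith : 0 < 1 - a / 24576)
  nlinarith

lemma jackson_abs (N : ℕ) (s : ℝ) : jackson N |s| = jackson N s := by
  rcases abs_choice s with h | h <;> rw [h]
  rw [jackson, jackson, dirichlet_neg]

lemma jackson_le_one_sub_sq {N : ℕ} (hN : 64 ≤ N) {s : ℝ} (hs : |s| ≤ 1 / 5) :
    jackson N s ≤ 1 - 57 / 10 * s ^ 2 := by
  rw [← jackson_abs, ← sq_abs]
  have hx : 0 ≤ |s| := abs_nonneg s
  set x := |s|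
  have hπ := pi_lt_d2
  have dirichlet_le : dirichlet N x ≤ 1 - 0.1625 * (3.14 * x) ^ 2 := by
    have : (3.14 * x) ^ 2 ≤ (π * x) ^ 2 := by gcongr; exact pi_gt_d2.le
    linarith [dirichlet_le_one_sub_sq hN hx (by nlinarith)]
  have hD : 0 ≤ dirichlet N x := dirichlet_nonneg (by rw [abs_of_nonneg hx]; linarith)
  have hx2 : x ^ 2 ≤ 1 / 25 := by nlinarith
  have hv0 : 0 ≤ 0.1625 * (3.14 * x) ^ 2 := by positivity
  have hv1 : 0.1625 * (3.14 * x) ^ 2 ≤ 0.0641 := by nlinarith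
  have hv : 5.7 * x ^ 2 ≤ 3.6154 * (0.1625 * (3.14 * x) ^ 2) := by nlinarith
  set v := 0.1625 * (3.14 * x) ^ 2
  calc jackson N x ≤ (1 - v) ^ 4 := pow_le_pow_left₀ hD dirichlet_le 4
    _ ≤ 1 - 3.6154 * v := by
      nlinarith [mul_nonneg hv0 hv0, mul_nonneg (mul_nonneg hv0 hv0) hv0]
    _ ≤ 1 - 57 / 10 * x ^ 2 := by linarith

lemma jackson_le_jackson_of_le_abs {N : ℕ} {s₀ s : ℝ} (h0 : 0 ≤ s₀) (hs : s₀ ≤ |s|)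
    (hs1 : |s| ≤ 1 / 2) : jackson N s ≤ jackson N s₀ := by
  rw [← jackson_abs]
  exact pow_le_pow_left₀ (dirichlet_nonneg (by rwa [abs_abs]))
    (dirichlet_antitone h0 hs (by linarith)) 4

lemma jackson_le_of_one_fifth_le {N : ℕ} (hN : 64 ≤ N) {s : ℝ} (hs : 1 / 5 ≤ |s|)
    (hs1 : |s| ≤ 1 / 2) : jackson N s ≤ 0.773 := by
  have at_endpoint := jackson_le_one_sub_sq hN (s := 1 / 5) (by rw [abs_of_pos (by norm_num)])
  linarith [jackson_le_jackson_of_le_abs (N := N) (by norm_num) hs hs1]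

lemma jackson_le_of_three_tenths_le {N : ℕ} (hN : 64 ≤ N) {s : ℝ} (hs : 3 / 10 ≤ |s|)
    (hs1 : |s| ≤ 1 / 2) : jackson N s ≤ 0.56 := by
  have hπ := pi_gt_d2
  have hπ' := pi_lt_d2
  have dirichlet_le : dirichlet N (3 / 10) ≤ 0.864 := by
    have h := dirichlet_mul_le hN (s := 3 / 10) (by norm_num) (by linarith)
    rw [show (π * (3 / 10)) ^ 4 = ((π * (3 / 10)) ^ 2) ^ 2 by ring] at h
    have : 0.887 ≤ (π * (3 / 10)) ^ 2 := by nlinarith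
    have : (π * (3 / 10)) ^ 2 ≤ 0.8931 := by nlinarith
    nlinarith
  have hD : 0 ≤ dirichlet N (3 / 10) := dirichlet_nonneg (by rw [abs_of_pos] <;> norm_num)
  calc jackson N s ≤ jackson N (3 / 10) := jackson_le_jackson_of_le_abs (by norm_num) hs hs1
    _ ≤ 0.864 ^ 4 := pow_le_pow_left₀ hD dirichlet_le 4
    _ ≤ 0.56 := by norm_num

lemma sineRamp_eq (N : ℕ) (s : ℝ) : sineRamp N s = N / (2 * π) * sin (2 * (π * s / N)) := by
  rw [sin_two_mul, sineRamp, chord, chordCos]; field_simp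

lemma abs_sub_sineRamp_le {N : ℕ} (hN : 64 ≤ N) (s : ℝ) :
    |s - sineRamp N s| ≤ 1 / 500 * |s| ^ 3 := by
  wlog hs : 0 ≤ s generalizing s
  · have h := this (-s) (by linarith)
    rwa [sineRamp_neg, abs_neg, sub_neg_eq_add, neg_add_eq_sub, abs_sub_comm] at h
  have hN' : (64 : ℝ) ≤ N := by exact_mod_cast hN
  have hz : 0 ≤ 2 * (π * s / N) := by positivity
  have hc : 0 ≤ N / (2 * π) := by positivity
  have upper : sineRamp N s ≤ s := by
    rw [sineRamp_eq]
    exact (mul_le_mul_of_nonneg_left (sin_le hz) hc).trans_eq (by field_simp)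
  have lower : s - 2 * π ^ 2 / (3 * N ^ 2) * s ^ 3 ≤ sineRamp N s := by
    rw [sineRamp_eq]
    refine Eq.trans_le ?_ (mul_le_mul_of_nonneg_left (sin_ge_sub_cube hz) hc)
    field_simp; ring
  have coeff_le : 2 * π ^ 2 / (3 * (N : ℝ) ^ 2) ≤ 1 / 500 := by
    rw [div_le_iff₀ (by positivity)]
    nlinarith [pi_lt_d2, pi_pos]
  rw [abs_of_nonneg (by linarith), abs_of_nonneg hs]
  linarith [mul_le_mul_of_nonneg_right coeff_le (by positivity : 0 ≤ s ^ 3)]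

/-! ### Sums over separated points -/

lemma abs_chord_eq {N : ℕ} (hN : 0 < N) {r : ℝ} (hr : |r| ≤ N / 2) :
    |chord N r| = chord N |r| := by
  have hN' : (0 : ℝ) < N := by exact_mod_cast hN
  have nonneg : 0 ≤ chord N |r| := by
    refine mul_nonneg hN'.le (sin_nonneg_of_nonneg_of_le_pi (by positivity) ?_)
    rw [div_le_iff₀ hN']
    nlinarith [pi_pos]
  rcases abs_choice r with h | h
  · rw [h] at nonneg ⊢
    exact abs_of_nonneg nonneg
  · rw [h, chord_neg] at nonneg ⊢
    exact abs_of_nonpos (neg_nonneg.1 nonneg)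

lemma chord_le_chord {N : ℕ} (hN : 0 < N) {x y : ℝ} (hx : 0 ≤ x) (hxy : x ≤ y)
    (hy : y ≤ N / 2) : chord N x ≤ chord N y := by
  have hN' : (0 : ℝ) < N := by exact_mod_cast hN
  refine mul_le_mul_of_nonneg_left (sin_le_sin_of_le_of_le_pi_div_two ?_ ?_ ?_) hN'.le
  · exact (neg_nonpos.2 (by positivity)).trans (by positivity : 0 ≤ π * x / N)
  · rw [div_le_iff₀ hN']; nlinarith [pi_pos]
  · gcongr

lemma mul_le_abs_chord {N : ℕ} (hN : 64 ≤ N) {x r : ℝ} (hx : 0 ≤ x) (hx5 : x ≤ 5)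
    (hxr : x ≤ |r|) (hr : |r| ≤ N / 2) : 3.1 * x ≤ |chord N r| := by
  have hπ := pi_gt_d2
  have hπ' := pi_lt_d2
  have correction_le : 0.9899 ≤ 1 - (π * x) ^ 2 / 24576 := by
    have : 0 ≤ π * x := by positivity
    have : π * x ≤ 15.75 := by nlinarith
    nlinarith
  calc 3.1 * x ≤ 3.14 * x * 0.9899 := by nlinarith
    _ ≤ π * x * (1 - (π * x) ^ 2 / 24576) := by gcongr
    _ ≤ chord N x := le_chord_of_nonneg hN hx
    _ ≤ chord N |r| := chord_le_chord (by omega) hx hxr hr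
    _ = |chord N r| := (abs_chord_eq (by omega) hr).symm

lemma two_mul_le_abs_chord {N : ℕ} (hN : 0 < N) {x r : ℝ} (hx : 0 ≤ x)
    (hxr : x ≤ |r|) (hr : |r| ≤ N / 2) : 2 * x ≤ |chord N r| := by
  have hN' : (0 : ℝ) < N := by exact_mod_cast hN
  calc 2 * x = N * (2 / π * (π * x / N)) := by field_simp
    _ ≤ chord N x := mul_le_mul_of_nonneg_left (mul_le_sin (by positivity) (by
        rw [div_le_iff₀ hN']; nlinarith [pi_pos])) hN'.le
    _ ≤ chord N |r| := chord_le_chord hN hx hxr hr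
    _ = |chord N r| := (abs_chord_eq hN hr).symm

/-- A lower bound, of the order of `m`, for `|chord N x|` on `m ≤ |x| ≤ N / 2`. It is almost sharp
for small `m`, which carry most of the weight in sums over separated points. -/
def chordLowerBound (m : ℕ) : ℝ := if m ≤ 5 then 3.1 * m else 2 * m

lemma chordLowerBound_nonneg (m : ℕ) : 0 ≤ chordLowerBound m := by
  rw [chordLowerBound]; split_ifs <;> positivity

lemma chordLowerBound_pos {m : ℕ} (hm : 1 ≤ m) : 0 < chordLowerBound m := by
  have : (0 : ℝ) < m := by exact_mod_cast hm
  rw [chordLowerBound]; split_ifs <;> positivity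

lemma chordLowerBound_floor_le {N : ℕ} (hN : 64 ≤ N) {x : ℝ} (hx : |x| ≤ N / 2) :
    chordLowerBound ⌊|x|⌋₊ ≤ |chord N x| := by
  have floor_le := Nat.floor_le (abs_nonneg x)
  rw [chordLowerBound]
  split_ifs with h5
  · exact mul_le_abs_chord hN (Nat.cast_nonneg _) (by exact_mod_cast h5) floor_le hx
  · exact two_mul_le_abs_chord (by omega) (Nat.cast_nonneg _) floor_le hx

lemma sum_chordLowerBound_cube_le {n : ℕ} (hn : 5 ≤ n) :
    ∑ m ∈ Finset.Icc 1 n, (chordLowerBound m)⁻¹ ^ 3 ≤ 0.042 - 1 / (16 * n * (n + 1)) := by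
  induction n, hn using Nat.le_induction with
  | base => norm_num [Finset.sum_Icc_succ_top, chordLowerBound]
  | succ n hn ih =>
    have : (5 : ℝ) ≤ n := by exact_mod_cast hn
    have step : (chordLowerBound (n + 1))⁻¹ ^ 3
        ≤ 1 / (16 * n * (n + 1)) - 1 / (16 * ((n + 1 : ℕ) : ℝ) * ((n + 1 : ℕ) + 1)) := by
      rw [chordLowerBound, if_neg (by omega)]
      push_cast
      rw [div_sub_div _ _ (by positivity) (by positivity), inv_pow, ← one_div,
        div_le_div_iff₀ (by positivity) (by positivity), ← sub_nonneg]
      calc (0 : ℝ) ≤ 256 * (n + 1) ^ 2 := by positivity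
        _ = _ := by ring
    rw [Finset.sum_Icc_succ_top (by omega)]
    linarith

lemma sum_chordLowerBound_fourth_le {n : ℕ} (hn : 5 ≤ n) :
    ∑ m ∈ Finset.Icc 1 n, (chordLowerBound m)⁻¹ ^ 4 ≤ 0.012 - 1 / (192 * n * (n + 1)) := by
  induction n, hn using Nat.le_induction with
  | base => norm_num [Finset.sum_Icc_succ_top, chordLowerBound]
  | succ n hn ih =>
    have hn' : (0 : ℝ) ≤ n - 5 := sub_nonneg.2 (by exact_mod_cast hn)
    have : (0 : ℝ) < n := by linarith
    have step : (chordLowerBound (n + 1))⁻¹ ^ 4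
        ≤ 1 / (192 * n * (n + 1)) - 1 / (192 * ((n + 1 : ℕ) : ℝ) * ((n + 1 : ℕ) + 1)) := by
      rw [chordLowerBound, if_neg (by omega)]
      push_cast
      rw [div_sub_div _ _ (by positivity) (by positivity), inv_pow, ← one_div,
        div_le_div_iff₀ (by positivity) (by positivity), ← sub_nonneg]
      calc (0 : ℝ) ≤ 6144 * (n + 1) ^ 2 * ((n - 5) * (n + 1) ^ 2 + 6) := by positivity
        _ = _ := by ring
    rw [Finset.sum_Icc_succ_top (by omega)]
    linarith

lemma abs_sub_lt_one_of_floor_abs_eq {x y : ℝ} (hfloor : ⌊|x|⌋₊ = ⌊|y|⌋₊)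
    (hsign : 0 ≤ x ↔ 0 ≤ y) : |x - y| < 1 := by
  have hx := Nat.floor_le (abs_nonneg x)
  have hx' := Nat.lt_floor_add_one |x|
  have hy := Nat.floor_le (abs_nonneg y)
  have hy' := Nat.lt_floor_add_one |y|
  rw [hfloor] at hx hx'
  generalize ⌊|y|⌋₊ = m at hx hx' hy hy'
  rw [abs_lt]
  rcases le_or_gt 0 x with h | h
  · rw [abs_of_nonneg h] at hx hx'
    rw [abs_of_nonneg (hsign.1 h)] at hy hy'
    constructor <;> linarith
  · rw [abs_of_neg h] at hx hx'
    rw [abs_of_neg (not_le.1 (mt hsign.2 h.not_ge))] at hy hy'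
    constructor <;> linarith

section Packing

variable {ι : Type*} {N : ℕ} {T : Finset ι} {r : ι → ℝ}

lemma injOn_floor_abs_sign (hsep : (T : Set ι).Pairwise fun k l => 1 ≤ |r k - r l|) :
    Set.InjOn (fun k => (⌊|r k|⌋₊, decide (0 ≤ r k))) T := by
  intro k hk l hl hkl
  by_contra hne
  obtain ⟨hfloor, hsign⟩ := Prod.mk.inj hkl
  exact (hsep hk hl hne).not_gt
    (abs_sub_lt_one_of_floor_abs_eq hfloor (by simpa only [decide_eq_decide] using hsign))

lemma sum_floor_abs_le {n : ℕ} (hsep : (T : Set ι).Pairwise fun k l => 1 ≤ |r k - r l|)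
    (h1 : ∀ k ∈ T, 1 ≤ |r k|) (hn : ∀ k ∈ T, |r k| ≤ n) {g : ℕ → ℝ} (hg : ∀ m, 0 ≤ g m) :
    ∑ k ∈ T, g ⌊|r k|⌋₊ ≤ 2 * ∑ m ∈ Finset.Icc 1 n, g m := by
  classical
  let bin : ι → ℕ × Bool := fun k => (⌊|r k|⌋₊, decide (0 ≤ r k))
  have image_subset : T.image bin ⊆ Finset.Icc 1 n ×ˢ (Finset.univ : Finset Bool) := by
    refine Finset.image_subset_iff.2 fun k hk => ?_
    simp only [bin, Finset.mem_product, Finset.mem_Icc, Finset.mem_univ, and_true]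
    exact ⟨Nat.le_floor (by exact_mod_cast h1 k hk), Nat.floor_le_of_le (hn k hk)⟩
  calc ∑ k ∈ T, g ⌊|r k|⌋₊ = ∑ x ∈ T.image bin, g x.1 :=
        (Finset.sum_image (f := fun x => g x.1) (injOn_floor_abs_sign hsep)).symm
    _ ≤ ∑ x ∈ Finset.Icc 1 n ×ˢ (Finset.univ : Finset Bool), g x.1 :=
      Finset.sum_le_sum_of_subset_of_nonneg image_subset fun x _ _ => hg _
    _ = 2 * ∑ m ∈ Finset.Icc 1 n, g m := by
      rw [Finset.sum_product, Finset.mul_sum]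
      simp

lemma sum_inv_chord_pow_le_of_one_le (hN : 64 ≤ N) (hr : ∀ k ∈ T, |r k| ≤ N / 2)
    (hsep : (T : Set ι).Pairwise fun k l => 1 ≤ |r k - r l|) (h1 : ∀ k ∈ T, 1 ≤ |r k|) (p : ℕ) :
    ∑ k ∈ T, |chord N (r k)|⁻¹ ^ p ≤ 2 * ∑ m ∈ Finset.Icc 1 N, (chordLowerBound m)⁻¹ ^ p := by
  refine (Finset.sum_le_sum fun k hk => ?_).trans (sum_floor_abs_le hsep h1
    (fun k hk => (hr k hk).trans (half_le_self N.cast_nonneg))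
    fun m => pow_nonneg (inv_nonneg.2 (chordLowerBound_nonneg m)) p)
  have := chordLowerBound_pos (Nat.le_floor (by exact_mod_cast h1 k hk) : 1 ≤ ⌊|r k|⌋₊)
  gcongr
  exact chordLowerBound_floor_le hN (hr k hk)

lemma sum_inv_chord_pow_le (hN : 64 ≤ N) (hr : ∀ k ∈ T, |r k| ≤ N / 2)
    (hsep : (T : Set ι).Pairwise fun k l => 1 ≤ |r k - r l|) {x : ℝ} (hx0 : 0 < x) (hx1 : x ≤ 1)
    (hx : ∀ k ∈ T, x ≤ |r k|) {n : ℕ} (hn : (T.filter fun k => |r k| < 1).card ≤ n) (p : ℕ) :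
    ∑ k ∈ T, |chord N (r k)|⁻¹ ^ p
      ≤ n * (3.1 * x)⁻¹ ^ p + 2 * ∑ m ∈ Finset.Icc 1 N, (chordLowerBound m)⁻¹ ^ p := by
  rw [← Finset.sum_filter_add_sum_filter_not T fun k => |r k| < 1]
  refine add_le_add ?_ ?_
  · refine (Finset.sum_le_card_nsmul _ _ ((3.1 * x)⁻¹ ^ p) fun k hk => ?_).trans ?_
    · have hkT := (Finset.mem_filter.1 hk).1
      have := mul_le_abs_chord hN hx0.le (by linarith) (hx k hkT) (hr k hkT)
      gcongr
    · rw [nsmul_eq_mul]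
      gcongr
  · refine sum_inv_chord_pow_le_of_one_le hN (fun k hk => hr k (Finset.mem_filter.1 hk).1)
      (hsep.mono (Finset.coe_subset.2 (Finset.filter_subset _ _))) (fun k hk => ?_) p
    exact not_lt.1 (Finset.mem_filter.1 hk).2

lemma sum_inv_chord_cube_le (hN : 64 ≤ N) (hr : ∀ k ∈ T, |r k| ≤ N / 2)
    (hsep : (T : Set ι).Pairwise fun k l => 1 ≤ |r k - r l|) {x : ℝ} (hx0 : 0 < x) (hx1 : x ≤ 1)
    (hx : ∀ k ∈ T, x ≤ |r k|) {n : ℕ} (hn : (T.filter fun k => |r k| < 1).card ≤ n) :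
    ∑ k ∈ T, |chord N (r k)|⁻¹ ^ 3 ≤ n * (3.1 * x)⁻¹ ^ 3 + 0.084 := by
  have tail_nonneg : (0 : ℝ) ≤ 1 / (16 * N * (N + 1)) := by positivity
  linarith [sum_inv_chord_pow_le hN hr hsep hx0 hx1 hx hn 3,
    sum_chordLowerBound_cube_le (by omega : 5 ≤ N)]

lemma sum_inv_chord_fourth_le (hN : 64 ≤ N) (hr : ∀ k ∈ T, |r k| ≤ N / 2)
    (hsep : (T : Set ι).Pairwise fun k l => 1 ≤ |r k - r l|) {x : ℝ} (hx0 : 0 < x) (hx1 : x ≤ 1)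
    (hx : ∀ k ∈ T, x ≤ |r k|) {n : ℕ} (hn : (T.filter fun k => |r k| < 1).card ≤ n) :
    ∑ k ∈ T, |chord N (r k)|⁻¹ ^ 4 ≤ n * (3.1 * x)⁻¹ ^ 4 + 0.024 := by
  have tail_nonneg : (0 : ℝ) ≤ 1 / (192 * N * (N + 1)) := by positivity
  linarith [sum_inv_chord_pow_le hN hr hsep hx0 hx1 hx hn 4,
    sum_chordLowerBound_fourth_le (by omega : 5 ≤ N)]

lemma card_abs_lt_one_le_two (hsep : (T : Set ι).Pairwise fun k l => 1 ≤ |r k - r l|) :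
    (T.filter fun k => |r k| < 1).card ≤ 2 := by
  refine (Finset.card_le_card_of_injOn (t := (Finset.univ : Finset Bool))
    (fun k => decide (0 ≤ r k)) (fun _ _ => Finset.mem_univ _) ?_).trans (by simp)
  intro k hk l hl hkl
  simp only [Finset.coe_filter, Set.mem_ofPred_eq] at hk hl
  refine injOn_floor_abs_sign hsep hk.1 hl.1 (Prod.ext ?_ hkl)
  exact (Nat.floor_eq_zero.2 hk.2).trans (Nat.floor_eq_zero.2 hl.2).symm

lemma card_abs_lt_one_le_one (hsep : (T : Set ι).Pairwise fun k l => 1 ≤ |r k - r l|) {x : ℝ}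
    (hx : |x| ≤ 1 / 2) (hxT : ∀ k ∈ T, 1 ≤ |r k - x|) :
    (T.filter fun k => |r k| < 1).card ≤ 1 := by
  rw [Finset.card_le_one]
  intro k hk l hl
  rw [Finset.mem_filter] at hk hl
  by_contra hne
  have hk1 := abs_lt.1 hk.2
  have hl1 := abs_lt.1 hl.2
  have hx' := abs_le.1 hx
  rcases le_abs'.1 (hsep hk.1 hl.1 hne) with h | h <;>
    rcases le_abs'.1 (hxT k hk.1) with h' | h' <;>
    rcases le_abs'.1 (hxT l hl.1) with h'' | h'' <;> linarith

end Packing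

/-! ### Reduction modulo a period -/

/-- The representative of `x` modulo `L` in `[-L / 2, L / 2]`. -/
def centeredMod (L x : ℝ) : ℝ := x - round (x / L) * L

lemma centeredMod_zero (L : ℝ) : centeredMod L 0 = 0 := by simp [centeredMod]

lemma abs_centeredMod_le {L : ℝ} (hL : 0 < L) (x : ℝ) : |centeredMod L x| ≤ L / 2 := by
  have factor : centeredMod L x = (x / L - round (x / L)) * L := by rw [centeredMod]; field_simp
  rw [factor, abs_mul, abs_of_pos hL]
  linarith [mul_le_mul_of_nonneg_right (abs_sub_round (x / L)) hL.le]

lemma centeredMod_eq_self {L x : ℝ} (hx : |x| < L / 2) : centeredMod L x = x := by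
  have hL : 0 < L := by linarith [abs_nonneg x]
  have round_eq : round (x / L) = 0 := by
    rw [round_eq_zero_iff, Set.mem_Ico, le_div_iff₀ hL, div_lt_iff₀ hL]
    constructor <;> linarith [abs_lt.1 hx]
  simp [centeredMod, round_eq]

lemma abs_chord_periodic {N : ℕ} (hN : N ≠ 0) :
    Function.Periodic (fun t => |chord N t|) (N : ℝ) := by
  intro t
  have shift : π * (t + N) / N = π * t / N + π := by field_simp
  simp only [chord, shift, sin_add_pi, mul_neg, abs_neg]

lemma dirichlet_add_natCast {N : ℕ} (hN : N ≠ 0) (t : ℝ) :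
    dirichlet N (t + N) = (-1) ^ (N + 1) * dirichlet N t := by
  have freq_shift (k : ℕ) : dirichletFreq N k * (t + N)
      = dirichletFreq N k * t + (k : ℤ) * (2 * π) + ((1 - N : ℤ) : ℝ) * π := by
    rw [dirichletFreq]; push_cast; field_simp; ring
  have parity : (-1 : ℝ) ^ ((1 : ℤ) - N) = (-1) ^ (N + 1) := by
    rw [show (1 : ℤ) - N = (N + 1 : ℕ) - 2 * (N : ℤ) by push_cast; ring,
      zpow_sub₀ (by norm_num), zpow_natCast, zpow_mul]
    norm_num
  simp only [dirichlet, freq_shift, cos_add_int_mul_pi, cos_add_int_mul_two_pi, parity,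
    mul_div_assoc', Finset.mul_sum]

lemma jackson_periodic {N : ℕ} (hN : N ≠ 0) : Function.Periodic (jackson N) (N : ℝ) := by
  intro t
  rw [jackson, jackson, dirichlet_add_natCast hN, mul_pow, ← pow_mul, mul_comm (N + 1) 4, pow_mul]
  norm_num

lemma abs_chord_centeredMod {N : ℕ} (hN : N ≠ 0) (x : ℝ) :
    |chord N (centeredMod N x)| = |chord N x| :=
  (abs_chord_periodic hN).sub_int_mul_eq _

lemma jackson_centeredMod {N : ℕ} (hN : N ≠ 0) (x : ℝ) :
    jackson N (centeredMod N x) = jackson N x :=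
  (jackson_periodic hN).sub_int_mul_eq _

lemma abs_sineRamp_le_abs_centeredMod {N : ℕ} (hN : N ≠ 0) (t : ℝ) :
    |sineRamp N t| ≤ |centeredMod N t| := by
  have hN' : (0 : ℝ) < N := by exact_mod_cast Nat.pos_of_ne_zero hN
  refine (abs_sineRamp_le N t).trans ?_
  rw [← abs_chord_centeredMod hN, div_le_iff₀ pi_pos, chord, abs_mul, abs_of_pos hN']
  refine (mul_le_mul_of_nonneg_left abs_sin_le_abs hN'.le).trans_eq ?_
  rw [abs_div, abs_mul, abs_of_pos pi_pos, abs_of_pos hN']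
  field_simp

/-- The points `τ i` are `1`-separated modulo `L`. -/
def SeparatedMod {ι : Type*} (L : ℝ) (τ : ι → ℝ) : Prop :=
  Pairwise fun i j => ∀ n : ℤ, 1 ≤ |τ i - τ j - n * L|

lemma SeparatedMod.pairwise_one_le_abs_sub {ι : Type*} {L : ℝ} {τ : ι → ℝ}
    (h : SeparatedMod L τ) (t : ℝ) :
    Pairwise fun i j => 1 ≤ |centeredMod L (t - τ i) - centeredMod L (t - τ j)| := by
  intro i j hij
  convert h hij.symm (round ((t - τ i) / L) - round ((t - τ j) / L)) using 2
  rw [centeredMod, centeredMod]; push_cast; ring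

/-! ### Sums of translated kernels -/

section TranslateSum

variable {ι : Type*} {u v u' v' : ℝ → ℝ} {τ : ι → ℝ} {T : Finset ι}

/-- The combination `∑ α k u (t - τ k) + β k v (t - τ k)` of translates of two kernels `u`, `v`. -/
def translateSum (u v : ℝ → ℝ) (τ : ι → ℝ) (α β : ι → ℂ) (T : Finset ι) (t : ℝ) : ℂ :=
  ∑ k ∈ T, (α k * u (t - τ k) + β k * v (t - τ k))

lemma hasDerivAt_translateSum (hu : ∀ t, HasDerivAt u (u' t) t) (hv : ∀ t, HasDerivAt v (v' t) t)
    (α β : ι → ℂ) (t : ℝ) :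
    HasDerivAt (translateSum u v τ α β T) (translateSum u' v' τ α β T t) t :=
  HasDerivAt.fun_sum fun k _ =>
    (((hu _).comp_sub_const t (τ k)).ofReal_comp.const_mul (α k)).add
    (((hv _).comp_sub_const t (τ k)).ofReal_comp.const_mul (β k))

lemma translateSum_add (α β α' β' : ι → ℂ) (t : ℝ) :
    translateSum u v τ (α + α') (β + β') T t
      = translateSum u v τ α β T t + translateSum u v τ α' β' T t := by
  simp only [translateSum, Pi.add_apply, ← Finset.sum_add_distrib]
  exact Finset.sum_congr rfl fun k _ => by ring

lemma translateSum_smul (c : ℂ) (α β : ι → ℂ) (t : ℝ) :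
    translateSum u v τ (c • α) (c • β) T t = c * translateSum u v τ α β T t := by
  simp only [translateSum, Pi.smul_apply, smul_eq_mul, Finset.mul_sum]
  exact Finset.sum_congr rfl fun k _ => by ring

lemma translateSum_univ_eq [Fintype ι] [DecidableEq ι] (α β : ι → ℂ) (j : ι) (t : ℝ) :
    translateSum u v τ α β Finset.univ t = α j * u (t - τ j) + β j * v (t - τ j)
      + translateSum u v τ α β (Finset.univ.erase j) t :=
  (Finset.add_sum_erase _ _ (Finset.mem_univ j)).symm

lemma translateSum_filter_add_filter_not (α β : ι → ℂ) (p : ι → Prop) [DecidablePred p] (t : ℝ) :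
    translateSum u v τ α β (T.filter p) t + translateSum u v τ α β (T.filter fun k => ¬ p k) t
      = translateSum u v τ α β T t :=
  Finset.sum_filter_add_sum_filter_not _ _ _

lemma norm_translateSum_le [Fintype ι] (α β : ι → ℂ) {x : ι → ℝ} {t c₁ c₂ c₃ P₃ P₄ : ℝ}
    (hc₁ : 0 ≤ c₁) (hc₂ : 0 ≤ c₂) (hc₃ : 0 ≤ c₃)
    (hu : ∀ k ∈ T, |u (t - τ k)| ≤ c₁ * x k ^ 4)
    (hv : ∀ k ∈ T, |v (t - τ k)| ≤ c₂ * x k ^ 3 + c₃ * x k ^ 4)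
    (hP₃ : ∑ k ∈ T, x k ^ 3 ≤ P₃) (hP₄ : ∑ k ∈ T, x k ^ 4 ≤ P₄) :
    ‖translateSum u v τ α β T t‖ ≤ ‖α‖ * (c₁ * P₄) + ‖β‖ * (c₂ * P₃ + c₃ * P₄) := by
  calc ‖translateSum u v τ α β T t‖
      ≤ ∑ k ∈ T, (‖α‖ * (c₁ * x k ^ 4) + ‖β‖ * (c₂ * x k ^ 3 + c₃ * x k ^ 4)) := by
        refine norm_sum_le_of_le _ fun k hk => (norm_add_le _ _).trans ?_
        rw [norm_mul, norm_mul, Complex.norm_real, Complex.norm_real]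
        exact add_le_add
          (mul_le_mul (norm_le_pi_norm α k) (hu k hk) (norm_nonneg _) (norm_nonneg _))
          (mul_le_mul (norm_le_pi_norm β k) (hv k hk) (norm_nonneg _) (norm_nonneg _))
    _ = ‖α‖ * (c₁ * ∑ k ∈ T, x k ^ 4)
        + ‖β‖ * (c₂ * ∑ k ∈ T, x k ^ 3 + c₃ * ∑ k ∈ T, x k ^ 4) := by
        rw [Finset.sum_add_distrib, ← Finset.mul_sum, ← Finset.mul_sum, ← Finset.mul_sum,
          Finset.sum_add_distrib, ← Finset.mul_sum, ← Finset.mul_sum]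
    _ ≤ _ := by gcongr

end TranslateSum

section JacksonSum

variable {ι : Type*} {N : ℕ} {τ : ι → ℝ} {T : Finset ι} {t X P₃ P₄ : ℝ}

/-- The sum `∑ α k jackson N (t - τ k) + β k oddJackson N (t - τ k)`, used for Hermite
interpolation at the nodes `τ k`. -/
def jacksonSum (N : ℕ) : (ι → ℝ) → (ι → ℂ) → (ι → ℂ) → Finset ι → ℝ → ℂ :=
  translateSum (jackson N) (oddJackson N)

/-- The derivative of `jacksonSum`. -/
def jacksonSumDeriv (N : ℕ) : (ι → ℝ) → (ι → ℂ) → (ι → ℂ) → Finset ι → ℝ → ℂ :=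
  translateSum (jacksonDeriv N) (oddJacksonDeriv N)

/-- The second derivative of `jacksonSum`. -/
def jacksonSumDeriv₂ (N : ℕ) : (ι → ℝ) → (ι → ℂ) → (ι → ℂ) → Finset ι → ℝ → ℂ :=
  translateSum (jacksonDeriv₂ N) (oddJacksonDeriv₂ N)

lemma hasDerivAt_jacksonSum (hN : N ≠ 0) (α β : ι → ℂ) (t : ℝ) :
    HasDerivAt (jacksonSum N τ α β T) (jacksonSumDeriv N τ α β T t) t :=
  hasDerivAt_translateSum (hasDerivAt_jackson N) (hasDerivAt_oddJackson hN) α β t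

lemma hasDerivAt_jacksonSumDeriv (hN : N ≠ 0) (α β : ι → ℂ) (t : ℝ) :
    HasDerivAt (jacksonSumDeriv N τ α β T) (jacksonSumDeriv₂ N τ α β T t) t :=
  hasDerivAt_translateSum (hasDerivAt_jacksonDeriv N) (hasDerivAt_oddJacksonDeriv hN) α β t

/-- Bounds for the inverse chords `|chord N (t - τ k)|⁻¹`, `k ∈ T`: each is at most `X`, and the
sums of their third and fourth powers are at most `P₃` and `P₄`. They control the contribution of
the nodes in `T` to a `jacksonSum` and its derivatives at `t`. -/
structure InvChordBounds (N : ℕ) (τ : ι → ℝ) (T : Finset ι) (t X P₃ P₄ : ℝ) : Prop where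
  chord_ne_zero : ∀ k ∈ T, chord N (t - τ k) ≠ 0
  nonneg : 0 ≤ X
  inv_chord_le : ∀ k ∈ T, |chord N (t - τ k)|⁻¹ ≤ X
  sum_cube_le : ∑ k ∈ T, |chord N (t - τ k)|⁻¹ ^ 3 ≤ P₃
  sum_fourth_le : ∑ k ∈ T, |chord N (t - τ k)|⁻¹ ^ 4 ≤ P₄

lemma InvChordBounds.mono {X' P₃' P₄' : ℝ} (h : InvChordBounds N τ T t X P₃ P₄) (hX : X ≤ X')
    (hP₃ : P₃ ≤ P₃') (hP₄ : P₄ ≤ P₄') : InvChordBounds N τ T t X' P₃' P₄' where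
  chord_ne_zero := h.chord_ne_zero
  nonneg := h.nonneg.trans hX
  inv_chord_le k hk := (h.inv_chord_le k hk).trans hX
  sum_cube_le := h.sum_cube_le.trans hP₃
  sum_fourth_le := h.sum_fourth_le.trans hP₄

lemma one_div_pi_le : 1 / π ≤ 0.3185 := by
  rw [div_le_iff₀ pi_pos]; linarith [pi_gt_d2]

lemma InvChordBounds.norm_jacksonSum_le [Fintype ι] (hN : N ≠ 0)
    (h : InvChordBounds N τ T t X P₃ P₄) (α β : ι → ℂ) :
    ‖jacksonSum N τ α β T t‖ ≤ ‖α‖ * P₄ + ‖β‖ * (0.3185 * P₃) := by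
  refine (norm_translateSum_le (c₁ := 1) (c₂ := 0.3185) (c₃ := 0) α β zero_le_one
    (by norm_num) le_rfl (fun k hk => ?_) (fun k hk => ?_) h.sum_cube_le
    h.sum_fourth_le).trans_eq (by ring)
  · rw [one_mul, abs_of_nonneg (jackson_nonneg _ _)]
    exact jackson_le_inv_chord hN (h.chord_ne_zero k hk)
  · rw [zero_mul, add_zero]
    refine (abs_oddJackson_le_inv_chord hN (h.chord_ne_zero k hk)).trans ?_
    gcongr
    exact one_div_pi_le

lemma InvChordBounds.norm_jacksonSumDeriv_le [Fintype ι] (hN : N ≠ 0)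
    (h : InvChordBounds N τ T t X P₃ P₄) (α β : ι → ℂ) :
    ‖jacksonSumDeriv N τ α β T t‖ ≤ ‖α‖ * (4 * π * (1 / 3 + X) * P₄)
      + ‖β‖ * (4 * (1 / 3 + X) * P₃ + P₄) := by
  have hX := h.nonneg
  refine (norm_translateSum_le (c₁ := 4 * π * (1 / 3 + X)) (c₂ := 4 * (1 / 3 + X)) (c₃ := 1) α β
    (by positivity) (by positivity) zero_le_one (fun k hk => ?_) (fun k hk => ?_)
    h.sum_cube_le h.sum_fourth_le).trans_eq (by ring)
  · refine (abs_jacksonDeriv_le_inv_chord hN (h.chord_ne_zero k hk)).trans ?_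
    have := h.inv_chord_le k hk
    gcongr
  · refine (abs_oddJacksonDeriv_le_inv_chord hN (h.chord_ne_zero k hk)).trans ?_
    have := h.inv_chord_le k hk
    rw [one_mul, add_comm]
    gcongr

lemma InvChordBounds.norm_jacksonSumDeriv₂_le [Fintype ι] (hN : 64 ≤ N)
    (h : InvChordBounds N τ T t X P₃ P₄) (α β : ι → ℂ) :
    ‖jacksonSumDeriv₂ N τ α β T t‖ ≤ ‖α‖ * (4 * π ^ 2 * (1 + 8 / 3 * X + 5 * X ^ 2) * P₄)
      + ‖β‖ * ((1 / 100 * (1 / π) + 4 * π * (1 + 8 / 3 * X + 5 * X ^ 2)) * P₃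
        + 8 * π * (1 / 3 + X) * P₄) := by
  have hN0 : N ≠ 0 := by omega
  have hX := h.nonneg
  refine norm_translateSum_le α β (by positivity) (by positivity) (by positivity) (fun k hk => ?_)
    (fun k hk => ?_) h.sum_cube_le h.sum_fourth_le
  · refine (abs_jacksonDeriv₂_le_inv_chord hN0 (h.chord_ne_zero k hk)).trans ?_
    have := h.inv_chord_le k hk
    gcongr
  · refine (abs_oddJacksonDeriv₂_le_inv_chord hN (h.chord_ne_zero k hk)).trans ?_
    have := h.inv_chord_le k hk
    rw [add_right_comm, add_mul, mul_assoc (1 / 100 : ℝ)]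
    gcongr

lemma SeparatedMod.invChordBounds (hN : 64 ≤ N) (hτ : SeparatedMod N τ) {x : ℝ} (hx0 : 0 < x)
    (hx1 : x ≤ 1) (hx : ∀ k ∈ T, x ≤ |centeredMod N (t - τ k)|) {n : ℕ}
    (hn : (T.filter fun k => |centeredMod N (t - τ k)| < 1).card ≤ n) :
    InvChordBounds N τ T t (3.1 * x)⁻¹ (n * (3.1 * x)⁻¹ ^ 3 + 0.084)
      (n * (3.1 * x)⁻¹ ^ 4 + 0.024) := by
  have hN0 : N ≠ 0 := by omega
  have hr : ∀ k ∈ T, |centeredMod N (t - τ k)| ≤ N / 2 := fun k _ =>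
    abs_centeredMod_le (by exact_mod_cast Nat.pos_of_ne_zero hN0) _
  have hsep := (hτ.pairwise_one_le_abs_sub t).set_pairwise (T : Set ι)
  have cube_le := sum_inv_chord_cube_le hN hr hsep hx0 hx1 hx hn
  have fourth_le := sum_inv_chord_fourth_le hN hr hsep hx0 hx1 hx hn
  have chord_ge : ∀ k ∈ T, 3.1 * x ≤ |chord N (t - τ k)| := fun k hk => by
    rw [← abs_chord_centeredMod hN0]
    exact mul_le_abs_chord hN hx0.le (by linarith) (hx k hk) (hr k hk)
  have hx' : 0 < 3.1 * x := by positivity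
  simp only [abs_chord_centeredMod hN0] at cube_le fourth_le
  exact ⟨fun k hk => abs_pos.1 (hx'.trans_le (chord_ge k hk)), by positivity,
    fun k hk => inv_anti₀ hx' (chord_ge k hk), cube_le, fourth_le⟩

lemma SeparatedMod.invChordBounds_erase [Fintype ι] [DecidableEq ι] (hN : 64 ≤ N)
    (hτ : SeparatedMod N τ) {x : ℝ} (hx0 : 1 / 2 ≤ x) (hx1 : x ≤ 1) {j : ι}
    (hj : |centeredMod N (t - τ j)| ≤ 1 - x) :
    InvChordBounds N τ (Finset.univ.erase j) t (3.1 * x)⁻¹ ((3.1 * x)⁻¹ ^ 3 + 0.084)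
      ((3.1 * x)⁻¹ ^ 4 + 0.024) := by
  have hsep := hτ.pairwise_one_le_abs_sub t
  have le_abs : ∀ k ∈ Finset.univ.erase j, x ≤ |centeredMod N (t - τ k)| := fun k hk => by
    linarith [hsep (Finset.ne_of_mem_erase hk),
      abs_sub (centeredMod N (t - τ k)) (centeredMod N (t - τ j))]
  have card_le := card_abs_lt_one_le_one (hsep.set_pairwise (Finset.univ.erase j : Finset ι))
    (hj.trans (by linarith)) fun k hk => hsep (Finset.ne_of_mem_erase hk)
  simpa using hτ.invChordBounds hN (by linarith) hx1 le_abs card_le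

lemma SeparatedMod.invChordBounds_node [Fintype ι] [DecidableEq ι] (hN : 64 ≤ N)
    (hτ : SeparatedMod N τ) (j : ι) :
    InvChordBounds N τ (Finset.univ.erase j) (τ j) 3.1⁻¹ 0.084 0.024 := by
  have one_le : ∀ k ∈ Finset.univ.erase j, 1 ≤ |centeredMod N (τ j - τ k)| := fun k hk => by
    simpa [centeredMod_zero] using hτ.pairwise_one_le_abs_sub (τ j) (Finset.ne_of_mem_erase hk)
  have card_le : ((Finset.univ.erase j).filter
      fun k => |centeredMod N (τ j - τ k)| < 1).card ≤ 0 :=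
    (Finset.card_eq_zero.2 (Finset.filter_eq_empty_iff.2 fun k hk => (one_le k hk).not_gt)).le
  simpa using hτ.invChordBounds hN one_pos le_rfl one_le card_le

end JacksonSum

/-! ### Hermite interpolation at separated nodes -/

section Hermite

variable {ι : Type*} [Fintype ι] {N : ℕ} {τ : ι → ℝ} {α β v w : ι → ℂ}

/-- The sum `jacksonSum N τ α β` solves the Hermite interpolation problem with values `v j` and
derivatives `w j` at the nodes `τ j`. -/
structure IsHermiteSum (N : ℕ) (τ : ι → ℝ) (α β v w : ι → ℂ) : Prop where
  value : ∀ j, jacksonSum N τ α β Finset.univ (τ j) = v j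
  deriv : ∀ j, jacksonSumDeriv N τ α β Finset.univ (τ j) = w j

lemma IsHermiteSum.value_sub_eq [DecidableEq ι] (h : IsHermiteSum N τ α β v w) (hN : N ≠ 0)
    (j : ι) :
    v j - α j = jacksonSum N τ α β (Finset.univ.erase j) (τ j) := by
  rw [← h.value j, jacksonSum, translateSum_univ_eq α β j]
  simp [jackson_zero hN, oddJackson_zero]

lemma IsHermiteSum.deriv_sub_eq [DecidableEq ι] (h : IsHermiteSum N τ α β v w) (hN : N ≠ 0)
    (j : ι) :
    w j - β j = jacksonSumDeriv N τ α β (Finset.univ.erase j) (τ j) := by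
  rw [← h.deriv j, jacksonSumDeriv, translateSum_univ_eq α β j]
  simp [jacksonDeriv_zero, oddJacksonDeriv_zero hN]

lemma IsHermiteSum.norm_value_sub_le (h : IsHermiteSum N τ α β v w) (hN : 64 ≤ N)
    (hτ : SeparatedMod N τ) (j : ι) : ‖v j - α j‖ ≤ 0.024 * ‖α‖ + 0.0268 * ‖β‖ := by
  classical
  rw [h.value_sub_eq (by omega)]
  refine ((hτ.invChordBounds_node hN j).norm_jacksonSum_le (by omega) α β).trans ?_
  linarith [norm_nonneg β]

lemma IsHermiteSum.norm_deriv_sub_le (h : IsHermiteSum N τ α β v w) (hN : 64 ≤ N)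
    (hτ : SeparatedMod N τ) (j : ι) : ‖w j - β j‖ ≤ 0.1984 * ‖α‖ + 0.2445 * ‖β‖ := by
  classical
  rw [h.deriv_sub_eq (by omega)]
  refine ((hτ.invChordBounds_node hN j).norm_jacksonSumDeriv_le (by omega) α β).trans ?_
  nlinarith [pi_lt_d2, norm_nonneg α, norm_nonneg β]

lemma IsHermiteSum.norm_valueCoeff_le (h : IsHermiteSum N τ α β v w) (hN : 64 ≤ N)
    (hτ : SeparatedMod N τ) : ‖α‖ ≤ ‖v‖ + (0.024 * ‖α‖ + 0.0268 * ‖β‖) :=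
  (pi_norm_le_iff_of_nonneg (by positivity)).2 fun j => by
    linarith [norm_le_insert (v j) (α j), h.norm_value_sub_le hN hτ j, norm_le_pi_norm v j]

lemma IsHermiteSum.norm_derivCoeff_le (h : IsHermiteSum N τ α β v w) (hN : 64 ≤ N)
    (hτ : SeparatedMod N τ) : ‖β‖ ≤ ‖w‖ + (0.1984 * ‖α‖ + 0.2445 * ‖β‖) :=
  (pi_norm_le_iff_of_nonneg (by positivity)).2 fun j => by
    linarith [norm_le_insert (w j) (β j), h.norm_deriv_sub_le hN hτ j, norm_le_pi_norm w j]

lemma SeparatedMod.exists_isHermiteSum (hτ : SeparatedMod N τ) (hN : 64 ≤ N) (v w : ι → ℂ) :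
    ∃ α β, IsHermiteSum N τ α β v w := by
  let Φ : ((ι → ℂ) × (ι → ℂ)) →ₗ[ℂ] ((ι → ℂ) × (ι → ℂ)) :=
    { toFun p := (fun j => jacksonSum N τ p.1 p.2 Finset.univ (τ j),
        fun j => jacksonSumDeriv N τ p.1 p.2 Finset.univ (τ j))
      map_add' p q := Prod.ext (funext fun _ => translateSum_add _ _ _ _ _)
        (funext fun _ => translateSum_add _ _ _ _ _)
      map_smul' c p := Prod.ext (funext fun _ => translateSum_smul _ _ _ _)
        (funext fun _ => translateSum_smul _ _ _ _) }
  have isHermiteSum_of_eq {α β v w : ι → ℂ} (h : Φ (α, β) = (v, w)) : IsHermiteSum N τ α β v w :=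
    ⟨congrFun (congrArg Prod.fst h), congrFun (congrArg Prod.snd h)⟩
  have ker_eq_bot : LinearMap.ker Φ = ⊥ := LinearMap.ker_eq_bot'.2 fun ⟨α, β⟩ hΦ => by
    have h := isHermiteSum_of_eq (v := 0) (w := 0) hΦ
    have hα := h.norm_valueCoeff_le hN hτ
    have hβ := h.norm_derivCoeff_le hN hτ
    rw [norm_zero, zero_add] at hα hβ
    have norm_β : ‖β‖ ≤ 0 := by linarith [norm_nonneg α]
    have norm_α : ‖α‖ ≤ 0 := by linarith
    rw [norm_le_zero_iff] at norm_α norm_β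
    rw [norm_α, norm_β, Prod.mk_zero_zero]
  obtain ⟨⟨α, β⟩, h⟩ :=
    LinearMap.injective_iff_surjective.1 (LinearMap.ker_eq_bot.1 ker_eq_bot) (v, w)
  exact ⟨α, β, isHermiteSum_of_eq h⟩

end Hermite

/-! ### A first order Taylor estimate -/

section Taylor

variable {E : Type*} [NormedAddCommGroup E] [NormedSpace ℝ E] {f f' f'' : ℝ → E} {C x s : ℝ}

lemma norm_sub_sub_smul_deriv_le_of_nonneg (hf : ∀ t, HasDerivAt f (f' t) t) (hs : 0 ≤ s)
    (hf' : ∀ t ∈ Set.Ico 0 s, ‖f' (x + t) - f' x‖ ≤ C * t) :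
    ‖f (x + s) - f x - s • f' x‖ ≤ C / 2 * s ^ 2 := by
  have hasDerivAt_remainder (t : ℝ) :
      HasDerivAt (fun t => f (x + t) - f x - t • f' x) (f' (x + t) - f' x) t :=
    ((((hf _).comp_const_add x t).sub_const _).sub ((hasDerivAt_id t).smul_const _)).congr_deriv
      (by rw [one_smul])
  have hasDerivAt_bound (t : ℝ) : HasDerivAt (fun t : ℝ => C / 2 * t ^ 2) (C * t) t :=
    ((hasDerivAt_pow 2 t).const_mul (C / 2)).congr_deriv (by push_cast; ring)
  exact image_norm_le_of_norm_deriv_right_le_deriv_boundary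
    (fun t _ => (hasDerivAt_remainder t).continuousAt.continuousWithinAt)
    (fun t _ => (hasDerivAt_remainder t).hasDerivWithinAt) (by simp) hasDerivAt_bound hf'
    ⟨hs, le_rfl⟩

lemma norm_sub_sub_smul_deriv_le_of_lipschitz (hf : ∀ t, HasDerivAt f (f' t) t)
    (hf' : ∀ t, |t| ≤ |s| → ‖f' (x + t) - f' x‖ ≤ C * |t|) :
    ‖f (x + s) - f x - s • f' x‖ ≤ C / 2 * s ^ 2 := by
  rcases le_total 0 s with hs | hs
  · refine norm_sub_sub_smul_deriv_le_of_nonneg hf hs fun t ht => ?_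
    simpa only [abs_of_nonneg ht.1] using
      hf' t (by rw [abs_of_nonneg ht.1, abs_of_nonneg hs]; exact ht.2.le)
  · have reflected := norm_sub_sub_smul_deriv_le_of_nonneg (f := fun t => f (-t))
      (f' := fun t => -f' (-t)) (C := C) (x := -x) (s := -s)
      (fun t => ((hf (-t)).scomp t (hasDerivAt_neg t)).congr_deriv (by simp)) (by linarith)
      fun t ht => by
        rw [neg_sub_neg, norm_sub_rev, neg_add, neg_neg]
        simpa only [abs_neg, abs_of_nonneg ht.1] using hf' (-t)
          (by rw [abs_neg, abs_of_nonneg ht.1, abs_of_nonpos hs]; exact ht.2.le)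
    simpa [add_comm s x] using reflected

lemma norm_sub_sub_smul_deriv_le (hf : ∀ t, HasDerivAt f (f' t) t)
    (hf' : ∀ t, HasDerivAt f' (f'' t) t) (hC : ∀ t, |t| ≤ |s| → ‖f'' (x + t)‖ ≤ C) :
    ‖f (x + s) - f x - s • f' x‖ ≤ C / 2 * s ^ 2 := by
  refine norm_sub_sub_smul_deriv_le_of_lipschitz hf fun t ht => ?_
  have lipschitz := (convex_Icc (-|s|) |s|).norm_image_sub_le_of_norm_hasDerivWithin_le
    (fun u _ => ((hf' (x + u)).comp_const_add x u).hasDerivWithinAt)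
    (fun u hu => hC u (abs_le.2 hu)) (x := 0) (y := t) ⟨by simp, by simp⟩ (abs_le.1 ht)
  simpa using lipschitz

end Taylor

/-! ### The dual certificate on the line -/

section Certificate

variable {ι : Type*} [Fintype ι] {N : ℕ} {τ : ι → ℝ} {α β v : ι → ℂ} {s t : ℝ}

lemma IsHermiteSum.norm_valueCoeff_le_of_norm_le_one (h : IsHermiteSum N τ α β v 0) (hN : 64 ≤ N)
    (hτ : SeparatedMod N τ) (hv : ‖v‖ ≤ 1) : ‖α‖ ≤ 1.033 := by
  have hα := h.norm_valueCoeff_le hN hτ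
  have hβ := h.norm_derivCoeff_le hN hτ
  rw [norm_zero] at hβ
  linarith

lemma IsHermiteSum.norm_derivCoeff_le_of_norm_le_one (h : IsHermiteSum N τ α β v 0) (hN : 64 ≤ N)
    (hτ : SeparatedMod N τ) (hv : ‖v‖ ≤ 1) : ‖β‖ ≤ 0.272 := by
  have hα := h.norm_valueCoeff_le hN hτ
  have hβ := h.norm_derivCoeff_le hN hτ
  rw [norm_zero] at hβ
  linarith

lemma SeparatedMod.norm_jacksonSumDeriv₂_erase_le [DecidableEq ι] (hτ : SeparatedMod N τ)
    (hN : 64 ≤ N) (hα : ‖α‖ ≤ 1.033) (hβ : ‖β‖ ≤ 0.272) (j : ι) (hs : |s| ≤ 1 / 5) :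
    ‖jacksonSumDeriv₂ N τ α β (Finset.univ.erase j) (τ j + s)‖ ≤ 7.7 := by
  have hN' : (64 : ℝ) ≤ N := by exact_mod_cast hN
  have near : |centeredMod N (τ j + s - τ j)| ≤ 1 - 0.8 := by
    rw [add_sub_cancel_left, centeredMod_eq_self (by linarith)]
    linarith
  have bounds := (hτ.invChordBounds_erase hN (by norm_num) (by norm_num) near).mono
    (X' := 0.40323) (P₃' := 0.14957) (P₄' := 0.05044) (by norm_num) (by norm_num) (by norm_num)
  have hπ := pi_lt_d4
  have sq_pi_le : π ^ 2 ≤ 9.87 := by nlinarith [pi_pos]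
  have inv_pi_le := one_div_pi_le
  calc _ ≤ _ := bounds.norm_jacksonSumDeriv₂_le hN α β
    _ ≤ 1.033 * (4 * π ^ 2 * (1 + 8 / 3 * 0.40323 + 5 * 0.40323 ^ 2) * 0.05044)
        + 0.272 * ((1 / 100 * (1 / π) + 4 * π * (1 + 8 / 3 * 0.40323 + 5 * 0.40323 ^ 2)) * 0.14957
        + 8 * π * (1 / 3 + 0.40323) * 0.05044) := by gcongr
    _ ≤ 7.7 := by linarith

lemma IsHermiteSum.norm_jacksonSum_erase_sub_add_le [DecidableEq ι]
    (h : IsHermiteSum N τ α β v 0) (hN : 64 ≤ N) (hτ : SeparatedMod N τ) (hv : ‖v‖ ≤ 1) (j : ι)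
    (hs : |s| ≤ 1 / 5) :
    ‖jacksonSum N τ α β (Finset.univ.erase j) (τ j + s) - (v j - α j) + s * β j‖
      ≤ 7.7 / 2 * s ^ 2 := by
  have hN0 : N ≠ 0 := by omega
  have taylor := norm_sub_sub_smul_deriv_le
    (hasDerivAt_jacksonSum (τ := τ) (T := Finset.univ.erase j) hN0 α β)
    (hasDerivAt_jacksonSumDeriv hN0 α β) (x := τ j) (s := s) fun x hx =>
      hτ.norm_jacksonSumDeriv₂_erase_le hN (h.norm_valueCoeff_le_of_norm_le_one hN hτ hv)
        (h.norm_derivCoeff_le_of_norm_le_one hN hτ hv) j (hx.trans hs)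
  rwa [← h.value_sub_eq hN0, ← h.deriv_sub_eq hN0, Pi.zero_apply, zero_sub, smul_neg,
    sub_neg_eq_add, Complex.real_smul] at taylor

lemma abs_sub_oddJackson_le (hN : 64 ≤ N) (hs : |s| ≤ 1 / 5) :
    |s - oddJackson N s| ≤ 0.2 * (1 - jackson N s) + 0.0004 * s ^ 2 := by
  have J_nonneg := jackson_nonneg N s
  have J_le := jackson_le_one N s
  have cubic_le : |s - sineRamp N s| ≤ 0.0004 * s ^ 2 := by
    refine (abs_sub_sineRamp_le hN s).trans ?_
    rw [← sq_abs s]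
    nlinarith [sq_nonneg |s|]
  calc |s - oddJackson N s|
      = |s * (1 - jackson N s) + (s - sineRamp N s) * jackson N s| := by rw [oddJackson]; ring_nf
    _ ≤ |s| * (1 - jackson N s) + |s - sineRamp N s| * jackson N s := by
        refine (abs_add_le _ _).trans_eq ?_
        rw [abs_mul, abs_mul, abs_of_nonneg J_nonneg, abs_of_nonneg (sub_nonneg.2 J_le)]
    _ ≤ 0.2 * (1 - jackson N s) + 0.0004 * s ^ 2 :=
        add_le_add (mul_le_mul_of_nonneg_right (by linarith) (by linarith))
          ((mul_le_of_le_one_right (abs_nonneg _) J_le).trans cubic_le)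

lemma IsHermiteSum.norm_jacksonSum_near_le (h : IsHermiteSum N τ α β v 0) (hN : 64 ≤ N)
    (hτ : SeparatedMod N τ) (hv : ‖v‖ ≤ 1) (j : ι) (hs : |s| ≤ 1 / 5) :
    ‖jacksonSum N τ α β Finset.univ (τ j + s)‖ ≤ 1 - s ^ 2 := by
  classical
  have hα := h.norm_valueCoeff_le_of_norm_le_one hN hτ hv
  have hβ := h.norm_derivCoeff_le_of_norm_le_one hN hτ hv
  set J := jackson N s
  have J_le : J ≤ 1 - 57 / 10 * s ^ 2 := jackson_le_one_sub_sq hN hs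
  have norm_main : ‖v j * J‖ ≤ J := by
    rw [norm_mul, Complex.norm_real, norm_of_nonneg (jackson_nonneg N s)]
    exact mul_le_of_le_one_left (jackson_nonneg N s) ((norm_le_pi_norm v j).trans hv)
  have norm_value : ‖(1 - J : ℝ) * (v j - α j)‖ ≤ (1 - J) * 0.033 := by
    rw [norm_mul, Complex.norm_real, norm_of_nonneg (sub_nonneg.2 (jackson_le_one N s))]
    exact mul_le_mul_of_nonneg_left (by linarith [h.norm_value_sub_le hN hτ j])
      (sub_nonneg.2 (jackson_le_one N s))
  have norm_remainder := h.norm_jacksonSum_erase_sub_add_le hN hτ hv j hs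
  have norm_deriv :
      ‖β j * (s - oddJackson N s : ℝ)‖ ≤ 0.272 * (0.2 * (1 - J) + 0.0004 * s ^ 2) := by
    rw [norm_mul, Complex.norm_real]
    exact mul_le_mul ((norm_le_pi_norm β j).trans hβ) (abs_sub_oddJackson_le hN hs)
      (norm_nonneg _) (by norm_num)
  have decomposition : jacksonSum N τ α β Finset.univ (τ j + s)
      = v j * J + (1 - J : ℝ) * (v j - α j)
        + (jacksonSum N τ α β (Finset.univ.erase j) (τ j + s) - (v j - α j) + s * β j)
        - β j * (s - oddJackson N s : ℝ) := by
    rw [jacksonSum, translateSum_univ_eq α β j, add_sub_cancel_left]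
    push_cast; ring
  rw [decomposition]
  exact (norm_sub_le_of_le (norm_add_le_of_le (norm_add_le_of_le norm_main norm_value)
    norm_remainder) norm_deriv).trans (by linarith [sq_nonneg s])

lemma norm_mul_jackson_add_mul_oddJackson_le (hN : N ≠ 0) {a b : ℂ} {c : ℝ}
    (hc : jackson N t ≤ c) :
    ‖a * jackson N t + b * oddJackson N t‖ ≤ ‖a‖ * c + ‖b‖ * (|centeredMod N t| * c) := by
  have J_nonneg := jackson_nonneg N t
  have ramp_le := abs_sineRamp_le_abs_centeredMod hN t
  refine (norm_add_le _ _).trans ?_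
  rw [norm_mul, norm_mul, Complex.norm_real, Complex.norm_real, oddJackson, norm_mul,
    norm_of_nonneg J_nonneg, norm_eq_abs]
  gcongr

lemma InvChordBounds.norm_jacksonSum_univ_le [DecidableEq ι] {j : ι} {c r X P₃ P₄ : ℝ}
    (h : InvChordBounds N τ (Finset.univ.erase j) t X P₃ P₄) (hN : N ≠ 0)
    (hc : jackson N (t - τ j) ≤ c) (hr : |centeredMod N (t - τ j)| ≤ r) (α β : ι → ℂ) :
    ‖jacksonSum N τ α β Finset.univ t‖ ≤ ‖α‖ * (c + P₄) + ‖β‖ * (r * c + 0.3185 * P₃) := by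
  have c_nonneg := (jackson_nonneg N _).trans hc
  have norm_own : ‖α j * jackson N (t - τ j) + β j * oddJackson N (t - τ j)‖
      ≤ ‖α‖ * c + ‖β‖ * (r * c) :=
    (norm_mul_jackson_add_mul_oddJackson_le hN hc).trans <| by
      gcongr <;> exact norm_le_pi_norm _ j
  calc _ ≤ (‖α‖ * c + ‖β‖ * (r * c)) + (‖α‖ * P₄ + ‖β‖ * (0.3185 * P₃)) := by
        rw [jacksonSum, translateSum_univ_eq α β j]
        exact norm_add_le_of_le norm_own (h.norm_jacksonSum_le hN α β)
    _ = _ := by ring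

lemma IsHermiteSum.norm_jacksonSum_far_le (h : IsHermiteSum N τ α β v 0) (hN : 64 ≤ N)
    (hτ : SeparatedMod N τ) (hv : ‖v‖ ≤ 1) (ht : ∀ j, 1 / 5 ≤ |centeredMod N (t - τ j)|) :
    ‖jacksonSum N τ α β Finset.univ t‖ ≤ 0.97 := by
  classical
  have hN0 : N ≠ 0 := by omega
  have hα := h.norm_valueCoeff_le_of_norm_le_one hN hτ hv
  have hβ := h.norm_derivCoeff_le_of_norm_le_one hN hτ hv
  have hsep := hτ.pairwise_one_le_abs_sub t
  by_cases hnear : ∃ j, |centeredMod N (t - τ j)| ≤ 1 / 2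
  · obtain ⟨j, hj⟩ := hnear
    rcases le_total |centeredMod N (t - τ j)| (3 / 10) with h3 | h3
    · have own_le := jackson_le_of_one_fifth_le hN (ht j) hj
      rw [jackson_centeredMod hN0] at own_le
      have others := (hτ.invChordBounds_erase hN (x := 0.7) (by norm_num) (by norm_num)
        (h3.trans (by norm_num))).mono le_rfl (P₃' := 0.182) (P₄' := 0.0692) (by norm_num)
        (by norm_num)
      linarith [others.norm_jacksonSum_univ_le hN0 own_le h3 α β]
    · have own_le := jackson_le_of_three_tenths_le hN h3 hj
      rw [jackson_centeredMod hN0] at own_le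
      have others := (hτ.invChordBounds_erase hN (x := 0.5) (by norm_num) (by norm_num)
        (hj.trans (by norm_num))).mono le_rfl (P₃' := 0.353) (P₄' := 0.198) (by norm_num)
        (by norm_num)
      linarith [others.norm_jacksonSum_univ_le hN0 own_le hj α β]
  · push Not at hnear
    have all := (hτ.invChordBounds hN (T := Finset.univ) (t := t) (x := 1 / 2) (n := 2)
      (by norm_num) (by norm_num) (fun j _ => (hnear j).le)
      (card_abs_lt_one_le_two (hsep.set_pairwise _))).mono le_rfl (P₃' := 0.622) (P₄' := 0.371)
      (by norm_num) (by norm_num)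
    linarith [all.norm_jacksonSum_le hN0 α β]

end Certificate

/-! ### Global bounds for Hermite interpolants -/

section Global

variable {ι : Type*} [Fintype ι] {N : ℕ} {τ : ι → ℝ} {α β v w : ι → ℂ}

lemma SeparatedMod.norm_translateSum_near_le (hτ : SeparatedMod N τ) {f g : ℝ → ℝ} {c d : ℝ}
    (hf : ∀ s, |centeredMod N s| < 1 → |f s| ≤ c) (hg : ∀ s, |centeredMod N s| < 1 → |g s| ≤ d)
    (hc : 0 ≤ c) (hd : 0 ≤ d) (α β : ι → ℂ) (t : ℝ) :
    ‖translateSum f g τ α β (Finset.univ.filter fun k => |centeredMod N (t - τ k)| < 1) t‖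
      ≤ ‖α‖ * (c * 2) + ‖β‖ * (d * 2) := by
  have card_le := card_abs_lt_one_le_two (T := Finset.univ)
    ((hτ.pairwise_one_le_abs_sub t).set_pairwise _)
  simpa using norm_translateSum_le (c₁ := c) (c₂ := d) (c₃ := 0) (x := 1) (P₃ := 2) (P₄ := 2)
    α β hc hd le_rfl
    (fun k hk => by simpa using hf _ (Finset.mem_filter.1 hk).2)
    (fun k hk => by simpa using hg _ (Finset.mem_filter.1 hk).2)
    (by simpa using card_le) (by simpa using card_le)

lemma SeparatedMod.invChordBounds_far (hτ : SeparatedMod N τ) (hN : 64 ≤ N) (t : ℝ) :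
    InvChordBounds N τ (Finset.univ.filter fun k => ¬ |centeredMod N (t - τ k)| < 1) t
      3.1⁻¹ 0.084 0.024 := by
  have one_le : ∀ k ∈ Finset.univ.filter fun k => ¬ |centeredMod N (t - τ k)| < 1,
      1 ≤ |centeredMod N (t - τ k)| := fun k hk => not_lt.1 (Finset.mem_filter.1 hk).2
  simpa using hτ.invChordBounds hN one_pos le_rfl one_le (n := 0)
    (Finset.card_eq_zero.2 (Finset.filter_eq_empty_iff.2 fun k hk => (one_le k hk).not_gt)).le

lemma SeparatedMod.norm_jacksonSum_le (hτ : SeparatedMod N τ) (hN : 64 ≤ N) (α β : ι → ℂ) (t : ℝ) :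
    ‖jacksonSum N τ α β Finset.univ t‖ ≤ 2.5 * (‖α‖ + ‖β‖) := by
  have hN0 : N ≠ 0 := by omega
  have abs_jackson_le (s : ℝ) : |jackson N s| ≤ 1 := by
    rw [abs_of_nonneg (jackson_nonneg N s)]
    exact jackson_le_one N s
  have abs_oddJackson_le (s : ℝ) (hs : |centeredMod N s| < 1) : |oddJackson N s| ≤ 1 := by
    rw [oddJackson, abs_mul]
    exact mul_le_one₀ ((abs_sineRamp_le_abs_centeredMod hN0 s).trans hs.le) (abs_nonneg _)
      (abs_jackson_le s)
  have near := hτ.norm_translateSum_near_le (fun s _ => abs_jackson_le s) abs_oddJackson_le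
    zero_le_one zero_le_one α β t
  have far := (hτ.invChordBounds_far hN t).norm_jacksonSum_le hN0 α β
  rw [jacksonSum, ← translateSum_filter_add_filter_not α β fun k => |centeredMod N (t - τ k)| < 1]
  refine (norm_add_le_of_le near far).trans ?_
  linarith [norm_nonneg α, norm_nonneg β]

lemma abs_oddJacksonDeriv₂_le (hN : 64 ≤ N) {t : ℝ} (ht : |centeredMod N t| ≤ 1) :
    |oddJacksonDeriv₂ N t| ≤ 190 := by
  have ramp_le := (abs_sineRamp_le_abs_centeredMod (by omega : N ≠ 0) t).trans ht
  have J_nonneg := jackson_nonneg N t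
  have π_lt := pi_lt_d2
  have term₀ : |sineRampDeriv₂ N t * jackson N t| ≤ 1 := by
    rw [abs_mul, abs_of_nonneg J_nonneg]
    exact mul_le_one₀ (by linarith [abs_sineRampDeriv₂_le hN t]) J_nonneg (jackson_le_one N t)
  have term₁ : |2 * sineRampDeriv N t * jacksonDeriv N t| ≤ 2 * (4 * π) := by
    rw [abs_mul, abs_mul, abs_two]
    exact mul_le_mul (by linarith [abs_sineRampDeriv_le N t]) (abs_jacksonDeriv_le N t)
      (abs_nonneg _) zero_le_two
  have term₂ : |sineRamp N t * jacksonDeriv₂ N t| ≤ 16 * π ^ 2 := by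
    rw [abs_mul]
    exact (mul_le_of_le_one_left (abs_nonneg _) ramp_le).trans (abs_jacksonDeriv₂_le N t)
  calc |oddJacksonDeriv₂ N t| ≤ 1 + 2 * (4 * π) + 16 * π ^ 2 :=
        (abs_add_le _ _).trans (add_le_add ((abs_add_le _ _).trans (add_le_add term₀ term₁)) term₂)
    _ ≤ 190 := by nlinarith [pi_pos]

lemma SeparatedMod.norm_jacksonSumDeriv₂_le (hτ : SeparatedMod N τ) (hN : 64 ≤ N) (α β : ι → ℂ)
    (t : ℝ) : ‖jacksonSumDeriv₂ N τ α β Finset.univ t‖ ≤ 400 * (‖α‖ + ‖β‖) := by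
  have π_lt := pi_lt_d2
  have sq_pi_le : π ^ 2 ≤ 10 := by nlinarith [pi_pos]
  have near := hτ.norm_translateSum_near_le (c := 160) (d := 190)
    (fun s _ => (abs_jacksonDeriv₂_le N s).trans (by linarith))
    (fun s hs => abs_oddJacksonDeriv₂_le hN hs.le) (by norm_num) (by norm_num) α β t
  have far := (hτ.invChordBounds_far hN t).norm_jacksonSumDeriv₂_le hN α β
  have valueFactor_le : 4 * π ^ 2 * (1 + 8 / 3 * 3.1⁻¹ + 5 * 3.1⁻¹ ^ 2) * 0.024 ≤ 20 := by
    linarith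
  have derivFactor_le : (1 / 100 * (1 / π) + 4 * π * (1 + 8 / 3 * 3.1⁻¹ + 5 * 3.1⁻¹ ^ 2)) * 0.084
      + 8 * π * (1 / 3 + 3.1⁻¹) * 0.024 ≤ 20 := by linarith [one_div_pi_le]
  rw [jacksonSumDeriv₂,
    ← translateSum_filter_add_filter_not α β fun k => |centeredMod N (t - τ k)| < 1]
  refine (norm_add_le_of_le near far).trans ?_
  linarith [mul_le_mul_of_nonneg_left valueFactor_le (norm_nonneg α),
    mul_le_mul_of_nonneg_left derivFactor_le (norm_nonneg β), norm_nonneg α, norm_nonneg β]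

lemma IsHermiteSum.norm_coeff_add_le (h : IsHermiteSum N τ α β v w) (hN : 64 ≤ N)
    (hτ : SeparatedMod N τ) : ‖α‖ + ‖β‖ ≤ 2 * (‖v‖ + ‖w‖) := by
  linarith [h.norm_valueCoeff_le hN hτ, h.norm_derivCoeff_le hN hτ, norm_nonneg v, norm_nonneg w,
    norm_nonneg α, norm_nonneg β]

lemma IsHermiteSum.norm_jacksonSum_le (h : IsHermiteSum N τ α β v w) (hN : 64 ≤ N)
    (hτ : SeparatedMod N τ) (t : ℝ) :
    ‖jacksonSum N τ α β Finset.univ t‖ ≤ 5 * (‖v‖ + ‖w‖) := by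
  linarith [hτ.norm_jacksonSum_le hN α β t, h.norm_coeff_add_le hN hτ]

lemma IsHermiteSum.norm_jacksonSumDeriv₂_le (h : IsHermiteSum N τ α β v w) (hN : 64 ≤ N)
    (hτ : SeparatedMod N τ) (t : ℝ) :
    ‖jacksonSumDeriv₂ N τ α β Finset.univ t‖ ≤ 800 * (‖v‖ + ‖w‖) := by
  linarith [hτ.norm_jacksonSumDeriv₂_le hN α β t, h.norm_coeff_add_le hN hτ]

end Global

/-! ### The kernels as trigonometric polynomials -/

/-- Trigonometric polynomials of degree at most `n`, pulled back along `ℝ → ℝ / ℤ`. The kernels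
are defined on the line, at scale `N`; this is where their degrees are counted. -/
def liftedTrigPoly (n : ℕ) : Submodule ℂ (ℝ → ℂ) :=
  (trigPoly n).map (LinearMap.funLeft ℂ ℂ ((↑) : ℝ → Torus))

lemma mem_liftedTrigPoly {n : ℕ} {f : ℝ → ℂ} :
    f ∈ liftedTrigPoly n ↔ ∃ T ∈ trigPoly n, ∀ x : ℝ, T (x : Torus) = f x := by
  simp only [liftedTrigPoly, Submodule.mem_map, funext_iff, LinearMap.funLeft_apply]

lemma liftedTrigPoly_mono {m n : ℕ} (h : m ≤ n) : liftedTrigPoly m ≤ liftedTrigPoly n :=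
  Submodule.map_mono (trigPoly_mono h)

lemma mul_mem_liftedTrigPoly {m n : ℕ} {f g : ℝ → ℂ} (hf : f ∈ liftedTrigPoly m)
    (hg : g ∈ liftedTrigPoly n) : f * g ∈ liftedTrigPoly (m + n) := by
  obtain ⟨T, hT, rfl⟩ := hf
  obtain ⟨U, hU, rfl⟩ := hg
  exact ⟨T * U, mul_mem_trigPoly hT hU, rfl⟩

lemma comp_sub_mem_liftedTrigPoly {n : ℕ} {f : ℝ → ℂ} (hf : f ∈ liftedTrigPoly n) (s : ℝ) :
    (fun x => f (x - s)) ∈ liftedTrigPoly n := by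
  obtain ⟨T, hT, rfl⟩ := hf
  exact ⟨_, comp_sub_mem_trigPoly hT s, rfl⟩

lemma cos_mem_liftedTrigPoly {n : ℕ} {m : ℤ} (hm : |m| ≤ n) :
    (fun x : ℝ => (cos (2 * π * m * x) : ℂ)) ∈ liftedTrigPoly n := by
  refine mem_liftedTrigPoly.2
    ⟨(1 / 2 : ℂ) • ((fun x => (fourier m x : ℂ)) + fun x => (fourier (-m) x : ℂ)),
    Submodule.smul_mem _ _ (Submodule.add_mem _ (fourier_mem_trigPoly hm)
      (fourier_mem_trigPoly (by rwa [abs_neg]))), fun x => ?_⟩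
  simp only [Pi.smul_apply, Pi.add_apply, smul_eq_mul, fourier_coe_apply]
  push_cast
  rw [Complex.cos]
  ring_nf

lemma sin_mem_liftedTrigPoly :
    (fun x : ℝ => (sin (2 * π * x) : ℂ)) ∈ liftedTrigPoly 1 := by
  refine mem_liftedTrigPoly.2
    ⟨(-Complex.I / 2 : ℂ) • ((fun x => (fourier 1 x : ℂ)) - fun x => (fourier (-1) x : ℂ)),
    Submodule.smul_mem _ _ (Submodule.sub_mem _ (fourier_mem_trigPoly (by simp))
      (fourier_mem_trigPoly (by simp))), fun x => ?_⟩
  simp only [Pi.smul_apply, Pi.sub_apply, smul_eq_mul, fourier_coe_apply]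
  push_cast
  rw [Complex.sin]
  ring_nf

lemma dirichletFreq_cos_mul_cos_mem_liftedTrigPoly {N k l : ℕ} (hk : k < N) (hl : l < N) :
    (fun x : ℝ => (cos (dirichletFreq N k * (N * x)) * cos (dirichletFreq N l * (N * x)) : ℂ))
      ∈ liftedTrigPoly (N - 1) := by
  have hN : (N : ℝ) ≠ 0 := by exact_mod_cast (by omega : N ≠ 0)
  have sum_mem := cos_mem_liftedTrigPoly (n := N - 1) (m := k + l + 1 - N) (by rw [abs_le]; omega)
  have diff_mem := cos_mem_liftedTrigPoly (n := N - 1) (m := k - l) (by rw [abs_le]; omega)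
  convert Submodule.smul_mem _ (1 / 2 : ℂ) (Submodule.add_mem _ sum_mem diff_mem) using 1
  ext x
  have freq_add : 2 * π * ((k + l + 1 - N : ℤ) : ℝ) * x
      = dirichletFreq N k * (N * x) + dirichletFreq N l * (N * x) := by
    simp only [dirichletFreq]; push_cast; field_simp; ring
  have freq_sub : 2 * π * ((k - l : ℤ) : ℝ) * x
      = dirichletFreq N k * (N * x) - dirichletFreq N l * (N * x) := by
    simp only [dirichletFreq]; push_cast; field_simp; ring
  simp only [Pi.smul_apply, Pi.add_apply, smul_eq_mul, freq_add, freq_sub, cos_add, cos_sub]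
  push_cast
  ring

lemma dirichlet_sq_mem_liftedTrigPoly (N : ℕ) :
    (fun x : ℝ => (dirichlet N (N * x) ^ 2 : ℂ)) ∈ liftedTrigPoly (N - 1) := by
  have sum_mem := Submodule.smul_mem _ (1 / (N : ℂ) ^ 2) <| Submodule.sum_mem _
    fun k (hk : k ∈ Finset.range N) => Submodule.sum_mem _ fun l (hl : l ∈ Finset.range N) =>
      dirichletFreq_cos_mul_cos_mem_liftedTrigPoly (Finset.mem_range.1 hk) (Finset.mem_range.1 hl)
  convert sum_mem using 1
  ext x
  simp only [Pi.smul_apply, Finset.sum_apply, smul_eq_mul, dirichlet, Complex.ofReal_div,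
    Complex.ofReal_sum, Complex.ofReal_natCast, div_pow, sq (∑ _ ∈ _, _), Finset.sum_mul_sum]
  ring

lemma jackson_mem_liftedTrigPoly (N : ℕ) :
    (fun x : ℝ => (jackson N (N * x) : ℂ)) ∈ liftedTrigPoly (2 * N - 2) := by
  have sq_mem := dirichlet_sq_mem_liftedTrigPoly N
  convert mul_mem_liftedTrigPoly sq_mem sq_mem using 1
  · congr 1
    omega
  · ext x
    simp only [jackson, Pi.mul_apply, Complex.ofReal_pow]
    ring

lemma sineRamp_natCast_mul {N : ℕ} (hN : N ≠ 0) (x : ℝ) :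
    sineRamp N (N * x) = N / (2 * π) * sin (2 * π * x) := by
  have arg_eq : π * (N * x) / N = π * x := by field_simp
  rw [sineRamp, chord, chordCos, arg_eq, mul_assoc 2, sin_two_mul]
  field_simp

lemma oddJackson_mem_liftedTrigPoly {N : ℕ} (hN : N ≠ 0) :
    (fun x : ℝ => (oddJackson N (N * x) : ℂ)) ∈ liftedTrigPoly (2 * N - 1) := by
  have mul_mem := Submodule.smul_mem _ ((N / (2 * π) : ℝ) : ℂ)
    (mul_mem_liftedTrigPoly sin_mem_liftedTrigPoly (jackson_mem_liftedTrigPoly N))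
  convert mul_mem using 1
  · congr 1
    omega
  · ext x
    simp only [oddJackson, sineRamp_natCast_mul hN, Pi.smul_apply, Pi.mul_apply, smul_eq_mul,
      Complex.ofReal_mul, mul_assoc]

lemma jacksonSum_mem_liftedTrigPoly {ι : Type*} [Fintype ι] {N M : ℕ} (hN : N ≠ 0)
    (hM : 2 * N - 1 ≤ M) (σ : ι → ℝ) (α β : ι → ℂ) :
    (fun x : ℝ => jacksonSum N (fun j => N * σ j) α β Finset.univ (N * x)) ∈ liftedTrigPoly M := by
  have jackson_mem := liftedTrigPoly_mono (by omega : 2 * N - 2 ≤ M) (jackson_mem_liftedTrigPoly N)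
  have oddJackson_mem := liftedTrigPoly_mono hM (oddJackson_mem_liftedTrigPoly hN)
  convert Submodule.sum_mem _ fun j (_ : j ∈ Finset.univ) => Submodule.add_mem _
    (Submodule.smul_mem _ (α j) (comp_sub_mem_liftedTrigPoly jackson_mem (σ j)))
    (Submodule.smul_mem _ (β j) (comp_sub_mem_liftedTrigPoly oddJackson_mem (σ j))) using 1
  ext x
  simp only [jacksonSum, translateSum, Finset.sum_apply, Pi.add_apply, Pi.smul_apply, smul_eq_mul,
    mul_sub]

/-! ### Calculus on the torus -/

lemma norm_le_lpNorm_exponent_top {X E : Type*} [TopologicalSpace X] [MeasurableSpace X]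
    [NormedAddCommGroup E] {ν : Measure X} [ν.IsOpenPosMeasure] {g : X → E} (hg : Continuous g)
    (hg' : MemLp g ∞ ν) (x : X) : ‖g x‖ ≤ lpNorm g ∞ ν :=
  (Measure.dense_of_ae (ae_le_lpNorm_exponent_top hg')).induction (fun _ => id)
    (isClosed_le hg.norm continuous_const) x

lemma quasiMeasurePreserving_coe_addCircle (T : ℝ) [Fact (0 < T)] :
    Measure.QuasiMeasurePreserving ((↑) : ℝ → AddCircle T) volume volume := by
  refine ⟨AddCircle.measurable_mk', Measure.AbsolutelyContinuous.mk fun s hs hs0 => ?_⟩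
  rw [Measure.map_apply AddCircle.measurable_mk' hs, ← Measure.restrict_univ (μ := volume),
    ← iUnion_Ioc_add_zsmul (Fact.out : 0 < T) 0, Measure.restrict_apply
      (AddCircle.measurable_mk' hs), Set.inter_iUnion, measure_iUnion_null_iff]
  intro n
  rw [← Measure.restrict_apply (AddCircle.measurable_mk' hs), add_zsmul, one_zsmul, ← add_assoc]
  exact (AddCircle.measurePreserving_mk T _).quasiMeasurePreserving.preimage_null hs0

section TorusCalculus

variable {K : Torus → ℂ}

lemma TorusDifferentiable.hasDerivAt (hK : TorusDifferentiable K) (z : Torus) (t : ℝ) :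
    HasDerivAt (fun u : ℝ => K (z + (u : Torus))) (torusDeriv K (z + (t : Torus))) t := by
  have hasDerivAt_zero : HasDerivAt (fun u : ℝ => K (z + (t : Torus) + (u : Torus)))
      (torusDeriv K (z + (t : Torus))) (t - t) := by
    rw [sub_self]
    exact (hK (z + (t : Torus))).hasDerivAt
  have translate_eq (u : ℝ) : z + (t : Torus) + ((u - t : ℝ) : Torus) = z + (u : Torus) := by
    rw [AddCircle.coe_sub]
    abel
  simpa only [translate_eq] using hasDerivAt_zero.comp_sub_const t t

lemma TorusDifferentiable.continuous (hK : TorusDifferentiable K) : Continuous K := by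
  refine isQuotientMap_quotient_mk'.continuous_iff.2 (continuous_iff_continuousAt.2 fun t => ?_)
  have continuousAt_lift := (hK.hasDerivAt 0 t).continuousAt
  simp only [zero_add] at continuousAt_lift
  exact continuousAt_lift

lemma TorusDifferentiable.memLp_top (hK : TorusDifferentiable K) : MemLp K ∞ volume :=
  hK.continuous.memLp_top_of_hasCompactSupport (HasCompactSupport.of_compactSpace K) volume

lemma TorusDifferentiable.norm_sub_le (hK : TorusDifferentiable K)
    (hK' : MemLp (torusDeriv K) ∞ volume) (z : Torus) (t : ℝ) :
    ‖K (z + (t : Torus)) - K z‖ ≤ lpNorm (torusDeriv K) ∞ volume * |t| := by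
  have deriv_le : ∀ᵐ u : ℝ, ‖torusDeriv K (z + (u : Torus))‖ ≤ lpNorm (torusDeriv K) ∞ volume :=
    ((measurePreserving_add_left volume z).quasiMeasurePreserving.comp
      (quasiMeasurePreserving_coe_addCircle 1)).ae (ae_le_lpNorm_exponent_top hK')
  have measurable_deriv : StronglyMeasurable fun u : ℝ => torusDeriv K (z + (u : Torus)) := by
    simpa only [← (hK.hasDerivAt z _).deriv] using
      stronglyMeasurable_deriv fun u : ℝ => K (z + (u : Torus))
  have intervalIntegrable_deriv :
      IntervalIntegrable (fun u : ℝ => torusDeriv K (z + (u : Torus))) volume 0 t := by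
    rw [intervalIntegrable_iff]
    exact Measure.integrableOn_of_bounded (by simp [Set.uIoc])
      measurable_deriv.aestronglyMeasurable (ae_restrict_of_ae deriv_le)
  have integral_deriv := intervalIntegral.integral_eq_sub_of_hasDerivAt
    (fun u _ => hK.hasDerivAt z u) intervalIntegrable_deriv
  rw [AddCircle.coe_zero, add_zero] at integral_deriv
  rw [← integral_deriv]
  simpa only [sub_zero] using intervalIntegral.norm_integral_le_of_norm_le_const_ae
    (a := 0) (b := t) (deriv_le.mono fun _ hu _ => hu)

lemma TorusDifferentiable.hasDerivAt_const_sub (hK : TorusDifferentiable K) (x y : Torus) :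
    HasDerivAt (fun t : ℝ => K (x - (y + (t : Torus)))) (-torusDeriv K (x - y)) 0 := by
  have reflect_eq (t : ℝ) : x - y + -(t : Torus) = x - (y + (t : Torus)) := by abel
  have hasDerivAt_reflect := (hK.hasDerivAt (x - y) (-0)).scomp 0 (hasDerivAt_neg (0 : ℝ))
  simpa [Function.comp_def, reflect_eq] using hasDerivAt_reflect

lemma TorusDifferentiable.const_sub (hK : TorusDifferentiable K) (x : Torus) :
    TorusDifferentiable fun y => K (x - y) :=
  fun y => (hK.hasDerivAt_const_sub x y).differentiableAt

lemma TorusDifferentiable.torusDeriv_const_sub (hK : TorusDifferentiable K) (x y : Torus) :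
    torusDeriv (fun y => K (x - y)) y = -torusDeriv K (x - y) :=
  (hK.hasDerivAt_const_sub x y).deriv

end TorusCalculus

/-! ### Interpolation on the torus -/

lemma MinSeparation.exists_separatedMod {M N : ℕ} {S : Finset Torus} (hS : MinSeparation M S)
    (hM : 0 < M) (hMN : M ≤ 2 * N) :
    ∃ σ : S → ℝ, (∀ s, (σ s : Torus) = s) ∧ SeparatedMod N fun s => N * σ s := by
  choose σ hσ using fun s : S => QuotientAddGroup.mk_surjective (s : Torus)
  refine ⟨σ, hσ, fun i j hij n => ?_⟩
  have hM' : (0 : ℝ) < M := by exact_mod_cast hM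
  have hMN' : (M : ℝ) ≤ 2 * N := by exact_mod_cast hMN
  have two_div_le : 2 / (M : ℝ) ≤ |σ i - σ j - n| := by
    calc 2 / (M : ℝ) ≤ dist (i : Torus) j := hS i i.2 j j.2 fun h => hij (Subtype.ext h)
      _ = ‖((σ i - σ j : ℝ) : Torus)‖ := by rw [dist_eq_norm, ← hσ i, ← hσ j]; rfl
      _ ≤ |σ i - σ j - n| := UnitAddCircle.norm_eq.trans_le (round_le _ n)
  calc (1 : ℝ) ≤ N * (2 / M) := by rw [mul_div_assoc', le_div_iff₀ hM']; linarith
    _ ≤ N * |σ i - σ j - n| := mul_le_mul_of_nonneg_left two_div_le N.cast_nonneg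
    _ = |N * σ i - N * σ j - n * N| := by rw [← Nat.abs_cast N, ← abs_mul, Nat.abs_cast]; ring_nf

lemma coe_add_centeredMod_div {N : ℕ} (hN : N ≠ 0) (x c : ℝ) :
    (c : Torus) + ((centeredMod N (N * x - N * c) / N : ℝ) : Torus) = x := by
  have shift_eq : c + centeredMod N (N * x - N * c) / N = x - round ((N * x - N * c) / N) := by
    rw [centeredMod]; field_simp; ring
  rw [← AddCircle.coe_add, shift_eq, AddCircle.coe_sub, sub_eq_self, AddCircle.coe_eq_zero_iff]
  exact ⟨round ((N * x - N * c) / N), by simp⟩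

lemma MinSeparation.exists_dualCertificate {M : ℕ} {S : Finset Torus} (hS : MinSeparation M S)
    (hM : 128 ≤ M) {v : S → ℂ} (hv : ‖v‖ ≤ 1) :
    ∃ f ∈ trigPoly M, (∀ s : S, f s = v s) ∧ ∀ y,
      (∃ (s : S) (r : ℝ), y = s + (r : Torus) ∧ (M * r) ^ 2 ≤ 4 * (1 - ‖f y‖)) ∨
        ‖f y‖ ≤ 0.97 := by
  obtain ⟨N, hN, hNM, hMN⟩ : ∃ N, 64 ≤ N ∧ 2 * N - 1 ≤ M ∧ M ≤ 2 * N :=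
    ⟨(M + 1) / 2, by omega, by omega, by omega⟩
  have hN0 : N ≠ 0 := by omega
  obtain ⟨σ, hσ, hτ⟩ := hS.exists_separatedMod (by omega) hMN
  obtain ⟨α, β, h⟩ := hτ.exists_isHermiteSum hN v 0
  obtain ⟨f, hf, hfx⟩ := mem_liftedTrigPoly.1 (jacksonSum_mem_liftedTrigPoly hN0 hNM σ α β)
  refine ⟨f, hf, fun s => by rw [← hσ s, hfx]; exact h.value s, fun y => ?_⟩
  obtain ⟨x, rfl⟩ := QuotientAddGroup.mk_surjective y
  by_cases far : ∀ s, 1 / 5 ≤ |centeredMod N (N * x - N * σ s)|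
  · exact Or.inr ((congrArg norm (hfx x)).trans_le (h.norm_jacksonSum_far_le hN hτ hv far))
  push Not at far
  obtain ⟨s, hs⟩ := far
  set t := centeredMod N (N * x - N * σ s)
  have y_eq : (x : Torus) = σ s + ((t / N : ℝ) : Torus) := (coe_add_centeredMod_div hN0 x _).symm
  have hN' : (0 : ℝ) < N := by exact_mod_cast Nat.pos_of_ne_zero hN0
  have norm_f_le : ‖f (x : Torus)‖ ≤ 1 - t ^ 2 := by
    rw [y_eq, ← AddCircle.coe_add, hfx, mul_add, mul_div_cancel₀ _ hN'.ne']
    exact h.norm_jacksonSum_near_le hN hτ hv s hs.le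
  refine Or.inl ⟨s, t / N, by rw [← hσ s]; exact y_eq, ?_⟩
  have div_le_two : (M : ℝ) / N ≤ 2 := (div_le_iff₀ hN').2 (by exact_mod_cast hMN)
  calc (M * (t / N)) ^ 2 = (M / N) ^ 2 * t ^ 2 := by ring
    _ ≤ 2 ^ 2 * t ^ 2 := by gcongr
    _ ≤ 4 * (1 - ‖f (x : Torus)‖) := by linarith

lemma MinSeparation.exists_hermiteInterpolant {M : ℕ} {S : Finset Torus} (hS : MinSeparation M S)
    (hM : 128 ≤ M) (v w : S → ℂ) :
    ∃ T ∈ trigPoly M, (∀ s : S, T s = v s) ∧ (∀ y, ‖T y‖ ≤ 10 * (‖v‖ + ‖w‖ / M)) ∧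
      ∀ (s : S) (r : ℝ), ‖T (s + (r : Torus)) - v s - r • w s‖
        ≤ 800 * (‖v‖ + ‖w‖ / M) * (M * r) ^ 2 := by
  obtain ⟨N, hN, hNM, hMN⟩ : ∃ N, 64 ≤ N ∧ 2 * N - 1 ≤ M ∧ M ≤ 2 * N :=
    ⟨(M + 1) / 2, by omega, by omega, by omega⟩
  have hN0 : N ≠ 0 := by omega
  obtain ⟨σ, hσ, hτ⟩ := hS.exists_separatedMod (by omega) hMN
  obtain ⟨α, β, h⟩ := hτ.exists_isHermiteSum hN v ((N : ℝ)⁻¹ • w)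
  obtain ⟨T, hT, hTx⟩ := mem_liftedTrigPoly.1 (jacksonSum_mem_liftedTrigPoly hN0 hNM σ α β)
  have hN' : (0 : ℝ) < N := by exact_mod_cast Nat.pos_of_ne_zero hN0
  have hMN' : (M : ℝ) ≤ 2 * N := by exact_mod_cast hMN
  have hNM' : (N : ℝ) ≤ M := by exact_mod_cast (by omega : N ≤ M)
  have : (0 : ℝ) < M := hN'.trans_le hNM'
  have data_le : ‖v‖ + ‖(N : ℝ)⁻¹ • w‖ ≤ 2 * (‖v‖ + ‖w‖ / M) := by
    have inv_le : (N : ℝ)⁻¹ ≤ 2 * (M : ℝ)⁻¹ := by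
      rw [← div_eq_mul_inv, inv_le_comm₀ hN' (by positivity), inv_div]
      linarith
    rw [norm_smul, Real.norm_of_nonneg (by positivity), div_eq_mul_inv]
    nlinarith [norm_nonneg v, mul_le_mul_of_nonneg_right inv_le (norm_nonneg w)]
  refine ⟨T, hT, fun s => by rw [← hσ s, hTx]; exact h.value s, fun y => ?_, fun s r => ?_⟩
  · obtain ⟨x, rfl⟩ := QuotientAddGroup.mk_surjective y
    refine (congrArg norm (hTx x)).trans_le ((h.norm_jacksonSum_le hN hτ _).trans ?_)
    linarith
  · have taylor := norm_sub_sub_smul_deriv_le (x := N * σ s) (s := N * r)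
      (hasDerivAt_jacksonSum hN0 α β) (hasDerivAt_jacksonSumDeriv hN0 α β)
      fun t _ => h.norm_jacksonSumDeriv₂_le hN hτ _
    rw [h.value s, h.deriv s, ← mul_add, ← hTx, AddCircle.coe_add, hσ, Pi.smul_apply, smul_smul,
      mul_right_comm, mul_inv_cancel₀ hN'.ne', one_mul] at taylor
    refine taylor.trans (mul_le_mul (by linarith) ?_ (by positivity) (by positivity))
    rw [mul_pow, mul_pow]
    gcongr

/-! ### The error bound -/

lemma TorusDifferentiable.norm_sub_sub_smul_torusDeriv_le {φ : Torus → ℂ} {L : ℝ}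
    (hφ : TorusDifferentiable φ)
    (hL : ∀ y (t : ℝ), ‖torusDeriv φ (y + (t : Torus)) - torusDeriv φ y‖ ≤ L * |t|)
    (z : Torus) (r : ℝ) :
    ‖φ (z + (r : Torus)) - φ z - r • torusDeriv φ z‖ ≤ L / 2 * r ^ 2 := by
  simpa using norm_sub_sub_smul_deriv_le_of_lipschitz (x := 0) (s := r) (hφ.hasDerivAt z)
    fun t _ => by simpa using hL z t

lemma conj_div_norm_mul_self {z : ℂ} (hz : z ≠ 0) : (starRingEnd ℂ) z / ‖z‖ * z = ‖z‖ := by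
  have : (‖z‖ : ℂ) ≠ 0 := by exact_mod_cast norm_ne_zero_iff.2 hz
  rw [div_mul_eq_mul_div, mul_comm, Complex.mul_conj', div_eq_iff this, sq]

lemma norm_conj_div_norm_le_one {ι : Type*} [Fintype ι] (a : ι → ℂ) :
    ‖fun i => (starRingEnd ℂ) (a i) / ‖a i‖‖ ≤ 1 := by
  refine (pi_norm_le_iff_of_nonneg zero_le_one).2 fun i => ?_
  rw [norm_div, RCLike.norm_conj, Complex.norm_real, norm_norm]
  exact div_self_le_one _

lemma norm_sub_le_mul_one_sub_of_dichotomy {M : ℕ} {S : Finset Torus} {f T φ : Torus → ℂ}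
    {L V : ℝ} (hM : (0 : ℝ) < M) (hφ : TorusDifferentiable φ)
    (hφL : ∀ y (t : ℝ), ‖torusDeriv φ (y + (t : Torus)) - torusDeriv φ y‖ ≤ L * |t|)
    (hφV : ∀ y, ‖φ y‖ ≤ V) (hL : 0 ≤ L) (hTV : ∀ y, ‖T y‖ ≤ 10 * V)
    (hT : ∀ (s : S) (r : ℝ),
      ‖T (s + (r : Torus)) - φ s - r • torusDeriv φ s‖ ≤ 800 * V * (M * r) ^ 2) {y : Torus}
    (hy : (∃ (s : S) (r : ℝ), y = s + (r : Torus) ∧ (M * r) ^ 2 ≤ 4 * (1 - ‖f y‖)) ∨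
      ‖f y‖ ≤ 0.97) :
    ‖φ y - T y‖ ≤ (3200 * V + 2 * (L / M ^ 2)) * (1 - ‖f y‖) := by
  have V_nonneg : 0 ≤ V := (norm_nonneg _).trans (hφV 0)
  have div_L_nonneg : 0 ≤ L / M ^ 2 := by positivity
  rcases hy with ⟨s, r, rfl, hr⟩ | far
  · calc ‖φ (s + (r : Torus)) - T (s + (r : Torus))‖
        ≤ L / 2 * r ^ 2 + 800 * V * (M * r) ^ 2 := by
          rw [← sub_sub_sub_cancel_right _ _ (φ s),
            ← sub_sub_sub_cancel_right _ _ (r • torusDeriv φ s)]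
          exact norm_sub_le_of_le (hφ.norm_sub_sub_smul_torusDeriv_le hφL s r) (hT s r)
      _ = (L / M ^ 2 / 2 + 800 * V) * (M * r) ^ 2 := by field_simp
      _ ≤ (L / M ^ 2 / 2 + 800 * V) * (4 * (1 - ‖f (s + (r : Torus))‖)) := by gcongr
      _ = (3200 * V + 2 * (L / M ^ 2)) * (1 - ‖f (s + (r : Torus))‖) := by ring
  · have gap_le : 0.03 ≤ 1 - ‖f y‖ := by linarith
    calc ‖φ y - T y‖ ≤ V + 10 * V := norm_sub_le_of_le (hφV y) (hTV y)
      _ ≤ (3200 * V + 2 * (L / M ^ 2)) * 0.03 := by linarith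
      _ ≤ (3200 * V + 2 * (L / M ^ 2)) * (1 - ‖f y‖) := by gcongr

theorem IsApproximation.norm_cintegral_sub_le {M : ℕ} {ε : ℝ≥0} {μ μ₀ : ComplexMeasure Torus}
    (hμ : IsApproximation ε M μ μ₀) (hμ₀ : IsSeparatedDiscrete M μ₀) (hM : 128 ≤ M)
    {φ : Torus → ℂ} (hφ : TorusDifferentiable φ) {L₀ L₁ L₂ : ℝ} (h₀ : ∀ y, ‖φ y‖ ≤ L₀)
    (h₁ : ∀ y, ‖torusDeriv φ y‖ ≤ L₁)
    (h₂ : ∀ y (t : ℝ), ‖torusDeriv φ (y + (t : Torus)) - torusDeriv φ y‖ ≤ L₂ * |t|) :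
    ‖cintegral (μ - μ₀) φ‖ ≤ 13000 * (L₀ + L₁ / M + L₂ / M ^ 2) * ε := by
  obtain ⟨S, a, hS, ha, rfl⟩ := hμ₀
  obtain ⟨f, hf, hfS, dichotomy⟩ := hS.exists_dualCertificate hM
    (norm_conj_div_norm_le_one fun s : S => a s)
  obtain ⟨T, hT, hTS, norm_T_le, taylor_T⟩ := hS.exists_hermiteInterpolant hM
    (fun s => φ s) fun s => torusDeriv φ s
  have hM' : (0 : ℝ) < M := by exact_mod_cast (by omega : 0 < M)
  have L₀_nonneg : 0 ≤ L₀ := (norm_nonneg _).trans (h₀ 0)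
  have L₁_nonneg : 0 ≤ L₁ := (norm_nonneg _).trans (h₁ 0)
  have L₂_nonneg : 0 ≤ L₂ := by simpa using (norm_nonneg _).trans (h₂ 0 1)
  have data_le : ‖fun s : S => φ s‖ + ‖fun s : S => torusDeriv φ s‖ / M ≤ L₀ + L₁ / M := by
    gcongr
    · exact (pi_norm_le_iff_of_nonneg L₀_nonneg).2 fun s => h₀ s
    · exact (pi_norm_le_iff_of_nonneg L₁_nonneg).2 fun s => h₁ s
  have div_L₁_nonneg : 0 ≤ L₁ / M := by positivity
  have div_L₂_nonneg : 0 ≤ L₂ / M ^ 2 := by positivity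
  have norm_f_le_one (y : Torus) : ‖f y‖ ≤ 1 := by
    rcases dichotomy y with ⟨_, r, -, hr⟩ | far
    · linarith [sq_nonneg (M * r)]
    · linarith
  have residual_le (y : Torus) :
      ‖φ y - T y‖ ≤ (3200 * (L₀ + L₁ / M) + 2 * (L₂ / M ^ 2)) * (1 - ‖f y‖) :=
    norm_sub_le_mul_one_sub_of_dichotomy hM' hφ h₂ (fun y => (h₀ y).trans (by linarith))
      L₂_nonneg (fun y => (norm_T_le y).trans (by gcongr)) (fun s r => (taylor_T s r).trans
      (by gcongr)) (dichotomy y)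
  refine (norm_cintegral_sub_le_of_certificate hμ hf norm_f_le_one (fun s hs => ?_) hT
    (fun y => (norm_T_le y).trans (mul_le_mul_of_nonneg_left data_le (by norm_num)))
    hφ.continuous (fun s hs => (hTS ⟨s, hs⟩).symm) (by positivity) residual_le).trans ?_
  · rw [hfS ⟨s, hs⟩, conj_div_norm_mul_self (ha s hs)]
  · gcongr
    linarith

theorem norm_conv_sub_le {M : ℕ} {ε : ℝ≥0} {μ₀ μ : ComplexMeasure Torus} {K : Torus → ℂ}
    (hM : 128 ≤ M) (hμ₀ : IsSeparatedDiscrete M μ₀) (hμ : IsApproximation ε M μ μ₀)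
    (hK : TorusDifferentiable K) (hK' : TorusDifferentiable (torusDeriv K))
    (hK'' : MemLp (torusDeriv (torusDeriv K)) ∞ volume) (x : Torus) :
    ‖conv K (μ - μ₀) x‖ ≤ 13000 * (lpNorm K ∞ volume + lpNorm (torusDeriv K) ∞ volume / M
      + lpNorm (torusDeriv (torusDeriv K)) ∞ volume / M ^ 2) * ε := by
  refine hμ.norm_cintegral_sub_le hμ₀ hM (hK.const_sub x)
    (fun y => norm_le_lpNorm_exponent_top hK.continuous hK.memLp_top _) (fun y => ?_)
    fun y t => ?_
  · rw [hK.torusDeriv_const_sub, norm_neg]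
    exact norm_le_lpNorm_exponent_top hK'.continuous hK'.memLp_top _
  · have shift_eq : x - (y + (t : Torus)) = x - y + ((-t : ℝ) : Torus) := by
      rw [AddCircle.coe_neg]
      abel
    rw [hK.torusDeriv_const_sub, hK.torusDeriv_const_sub, ← neg_sub', norm_neg, shift_eq,
      ← abs_neg t]
    exact hK'.norm_sub_le hK'' _ _

lemma ofReal_add_div_add_div_sq {a b c m : ℝ} (ha : 0 ≤ a) (hb : 0 ≤ b) (hc : 0 ≤ c)
    (hm : 0 < m) :
    ENNReal.ofReal (a + b / m + c / m ^ 2) = ENNReal.ofReal a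
      + (ENNReal.ofReal m)⁻¹ * ENNReal.ofReal b
      + (ENNReal.ofReal m ^ 2)⁻¹ * ENNReal.ofReal c := by
  rw [ENNReal.ofReal_add (by positivity) (by positivity), ENNReal.ofReal_add ha (by positivity),
    ENNReal.ofReal_div_of_pos hm, ENNReal.ofReal_div_of_pos (by positivity),
    ENNReal.ofReal_pow hm.le, ENNReal.div_eq_inv_mul, ENNReal.div_eq_inv_mul]

end SuperResolution

end

theorem theorem1 :
    ∃ C : ℝ≥0, 0 < C ∧
      ∀ (M : ℕ), 128 ≤ M →
      ∀ (ε : ℝ≥0) (μ₀ μ : ComplexMeasure SuperResolution.Torus),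
        SuperResolution.IsSeparatedDiscrete M μ₀ →
        SuperResolution.IsApproximation ε M μ μ₀ →
      ∀ K : SuperResolution.Torus → ℂ,
        SuperResolution.TorusDifferentiable K →
        SuperResolution.TorusDifferentiable (SuperResolution.torusDeriv K) →
        MemLp (SuperResolution.torusDeriv (SuperResolution.torusDeriv K)) ∞ volume →
        eLpNorm (SuperResolution.conv K (μ - μ₀)) ∞ volume ≤
          (C : ℝ≥0∞) * (ε : ℝ≥0∞) *
            (eLpNorm K ∞ volume
              + (M : ℝ≥0∞)⁻¹ * eLpNorm (SuperResolution.torusDeriv K) ∞ volume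
              + ((M : ℝ≥0∞) ^ 2)⁻¹ *
                eLpNorm (SuperResolution.torusDeriv (SuperResolution.torusDeriv K)) ∞ volume) := by
  refine ⟨13000, by norm_num, fun M hM ε μ₀ μ hμ₀ hμ K hK hK' hK'' => ?_⟩
  have hM' : (0 : ℝ) < M := by exact_mod_cast (by omega : 0 < M)
  calc eLpNorm (SuperResolution.conv K (μ - μ₀)) ∞ volume
      ≤ ENNReal.ofReal (13000 * (lpNorm K ∞ volume
          + lpNorm (SuperResolution.torusDeriv K) ∞ volume / M
          + lpNorm (SuperResolution.torusDeriv (SuperResolution.torusDeriv K)) ∞ volume / M ^ 2)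
          * ε) :=
        eLpNormEssSup_le_of_ae_bound (Filter.Eventually.of_forall
          (SuperResolution.norm_conv_sub_le hM hμ₀ hμ hK hK' hK''))
    _ = _ := by
        rw [mul_right_comm, ENNReal.ofReal_mul (by positivity), ENNReal.ofReal_mul (by norm_num),
          SuperResolution.ofReal_add_div_add_div_sq lpNorm_nonneg lpNorm_nonneg lpNorm_nonneg hM',
          ofReal_lpNorm hK.memLp_top, ofReal_lpNorm hK'.memLp_top, ofReal_lpNorm hK'',
          ENNReal.ofReal_natCast, ENNReal.ofReal_coe_nnreal]
        norm_num
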